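/- All graphs are finite and simple. For an integer $t\ge 1$, a $t$-edge-coloured graph is a graph $G$ together with an arbitrary (not necessarily proper) function $c:E(G)\to\{1,\dots,t\}$. A rainbow copy of a graph $H$ in it is a (not necessarily induced) subgraph of $G$ isomorphic to $H$ whose edges have pairwise distinct colours. Such a coloured graph is $\mathfrak R(H)$-saturated if it contains no rainbow copy of $H$, but adding any non-edge of $G$ in any colour from $\{1,\dots,t\}$ creates a rainbow copy of $H$. Let $\operatorname{sat}_t(n,\mathfrak R(H))$ be the minimum number of edges in an $\mathfrak R(H)$-saturated $t$-edge-coloured graph on $n$ vertices. Write $e(H)$ for the number of edges and $|H|$ for the number of vertices of $H$. A vertex of $H$ is conical if its degree is $|H|-1$; an edge is pendant if one of its endpoints has degree $1$; a star is a graph $K_{1,k}$. For $r\ge 4$, $K_r$ with a rotated edge is the graph obtained from $K_r$ by adding a new vertex $w$ and replacing one edge $uv$ of $K_r$ by the edge $uw$. Theorem. Let $H$ be a connected graph on at least $3$ vertices and let $t\ge e(H)$. Then, for fixed $H$ and $t$ and as $n\to\infty$: (i) $\operatorname{sat}_t(n,\mathfrak R(H))=\Theta(n^2)$ if $H$ is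 a star; (ii) $\operatorname{sat}_t(n,\mathfrak R(H))=\Theta(n\log n)$ if $H$ has a conical vertex but is not a star; (iii) $\operatorname{sat}_t(n,\mathfrak R(H))=\Theta(n\log n)$ if every edge of $H$ lies in a triangle; (iv) $\operatorname{sat}_t(n,\mathfrak R(H))=\Theta(n)$ if $H$ contains a non-pendant edge which does not lie in a triangle; (v) $\operatorname{sat}_t(n,\mathfrak R(H))=\Theta(n)$ if $H$ is $K_r$ with a rotated edge for some even $r\ge 4$. -/

import Mathlib

open scoped Asymptotics

namespace RainbowSat

/-- An edge-coloured graph `(G, c)` on the vertex set `V` with colours in `K`: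
a simple graph together with an arbitrary (not necessarily proper) colouring of its edges. -/
structure ColouredGraph (V K : Type*) where
  graph : SimpleGraph V
  colour : graph.EdgeLabeling K

namespace ColouredGraph

variable {V W K : Type*}

open Classical in
/-- The coloured graph obtained by adding the edge `xy` in colour `i`; the edges already present
keep their colours. It is only used for a non-edge `xy` with `x ≠ y`. -/
noncomputable def addEdge (G : ColouredGraph W K) (x y : W) (i : K) : ColouredGraph W K where
  graph := G.graph ⊔ SimpleGraph.edge x y
  colour := fun e => if h : e.1 ∈ G.graph.edgeSet then G.colour ⟨e.1, h⟩ else i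

/-- `G` contains a rainbow copy of `H`: a (not necessarily induced) copy of `H` in the underlying
graph whose edges receive pairwise distinct colours. -/
def HasRainbowCopy (H : SimpleGraph V) (G : ColouredGraph W K) : Prop :=
  ∃ f : SimpleGraph.Copy H G.graph,
    Function.Injective fun e : H.edgeSet => G.colour (f.mapEdgeSet e)

/-- `G` is rainbow `H`-saturated with respect to the palette `K`: it has no rainbow copy of `H`,
but adding any non-edge in any colour of the palette creates one. -/
def IsRainbowSaturated (H : SimpleGraph V) (G : ColouredGraph W K) : Prop :=
  ¬ G.HasRainbowCopy H ∧
    ∀ x y : W, x ≠ y → ¬ G.graph.Adj x y → ∀ i : K, (G.addEdge x y i).HasRainbowCopy H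

end ColouredGraph

/-- The `t`-rainbow saturation number `sat_t(n, R(H))`: the least number of edges of a
rainbow `H`-saturated `t`-edge-coloured graph on `n` vertices. -/
noncomputable def rainbowSat {V : Type*} (H : SimpleGraph V) (t n : ℕ) : ℕ :=
  sInf {m : ℕ | ∃ G : ColouredGraph (Fin n) (Fin t),
    G.IsRainbowSaturated H ∧ G.graph.edgeSet.ncard = m}

section Graphs

variable {V : Type*}

/-- `H` is a star `K_{1,k}`. -/
def IsStar (H : SimpleGraph V) : Prop :=
  ∃ k : ℕ, Nonempty (H ≃g completeBipartiteGraph (Fin 1) (Fin k))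

/-- The vertex `v` is conical: its degree is `|H| - 1`. -/
def IsConical (H : SimpleGraph V) (v : V) : Prop :=
  (H.neighborSet v).ncard = Nat.card V - 1

/-- The pair `xy` is a pendant edge: an edge one of whose endpoints has degree `1`. -/
def IsPendantEdge (H : SimpleGraph V) (x y : V) : Prop :=
  H.Adj x y ∧ ((H.neighborSet x).ncard = 1 ∨ (H.neighborSet y).ncard = 1)

/-- The pair `xy` is an edge lying in a triangle. -/
def IsTriangleEdge (H : SimpleGraph V) (x y : V) : Prop :=
  H.Adj x y ∧ ∃ z, H.Adj x z ∧ H.Adj y z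

/-- `K_r` with a rotated edge (for `r ≥ 2`), on the vertices `0, …, r`: the clique on
`0, …, r - 1` with the edge `{0, 1}` replaced by the edge `{0, r}`. -/
def rotatedClique (r : ℕ) : SimpleGraph (Fin (r + 1)) :=
  SimpleGraph.fromRel fun i j =>
    (i.val < r ∧ j.val < r ∧ ¬ (i.val = 0 ∧ j.val = 1) ∧ ¬ (i.val = 1 ∧ j.val = 0)) ∨
      (i.val = 0 ∧ j.val = r)

end Graphs

end RainbowSat

namespace RainbowSat

open Function

/-! ### Rainbow copies, saturation and reduction to rainbow-free constructions -/

section Basics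

variable {V W W' K : Type*}

/-! Upper bounds: a rainbow-free coloured graph always extends to a saturated one
(`exists_saturated_extension`), so it suffices to build a rainbow-free graph in which all but few
pairs, once joined in any colour, complete a rainbow `H`.

For an edge `uv` of `H`, attach copies of `H - u - v` to a large independent set `X` whose vertices
play `u` or `v`. For every edge `i` of `H` there is a copy in which `i` takes the colour of `uv`;
when `xy` is added in the colour of `i`, that copy becomes rainbow (`rainbowIn_of_blowUp_le`). If
`uv` lies in a triangle, the roles follow the binary digits of labels of `X`, which costs `O(log n)`
copies. If `uv` is in no triangle, a vertex can play both roles at once and `O(1)` copies suffice.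
Rainbow-freeness is the heart: a rainbow copy of `H` would induce an `IsFold`, and counting edges
makes that rigid enough to be contradictory (`IsFold.false_of_triangle`;
`IsFold.false_of_not_triangle`, with `uv` of maximal degree sum).

For rotated cliques of even order, take disjoint bounded pieces of a triangle-free linear hypergraph
whose blocks are rainbow cliques, properly coloured overall, with every colour in each block and at
each vertex (`isRainbowSystem_system`). A pendant edge leaving a block repeats a colour of that
block, but a new edge of colour `j` replaces an edge of colour `j` at its end.

Lower bounds: if nonadjacent vertices with equal labels, from a bounded set, always have a common
neighbour joined to them in different colours, a random colouring of the vertices shows that few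
vertices have degree below `c log n` (`card_filter_degree_le`). For triangle edges one label is
enough. For a conical vertex the label is the set of colours avoidable at `x` (`AvoidsAt`); for a
star, equal labels even force adjacency. The linear bound holds because at most one vertex is
isolated. -/

/-- The graph `G`, with the pairs of vertices coloured by `χ`, contains a rainbow copy of `H`. -/
def RainbowIn (H : SimpleGraph V) (G : SimpleGraph W) (χ : Sym2 W → K) : Prop :=
  ∃ f : V → W, Injective f ∧ (∀ a b, H.Adj a b → G.Adj (f a) (f b)) ∧
    Set.InjOn (fun e : Sym2 V => χ (e.map f)) H.edgeSet

open Classical in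
/-- Every non-edge of `G`, added in any colour, creates a rainbow copy of `H`,
and `G` contains none. -/
def Saturated (H : SimpleGraph V) (G : SimpleGraph W) (χ : Sym2 W → K) : Prop :=
  ¬ RainbowIn H G χ ∧ ∀ x y : W, x ≠ y → ¬ G.Adj x y → ∀ i : K,
    RainbowIn H (G ⊔ SimpleGraph.edge x y) (update χ s(x, y) i)

theorem hasRainbowCopy_iff (H : SimpleGraph V) (G : ColouredGraph W K) (χ : Sym2 W → K)
    (hχ : ∀ e : G.graph.edgeSet, χ e = G.colour e) :
    G.HasRainbowCopy H ↔ RainbowIn H G.graph χ := by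
  constructor
  · rintro ⟨f, hf⟩
    refine ⟨f, f.injective, fun a b h => f.toHom.map_adj h, ?_⟩
    intro e he e' he' h
    have := @hf ⟨e, he⟩ ⟨e', he'⟩ (by
      simp only [← hχ]
      exact h)
    exact congrArg Subtype.val this
  · rintro ⟨f, hf, hadj, hinj⟩
    refine ⟨⟨⟨f, fun {a b} h => hadj a b h⟩, hf⟩, ?_⟩
    intro e e' h
    simp only [← hχ] at h
    exact Subtype.ext (hinj e.2 e'.2 h)

theorem isRainbowSaturated_iff (H : SimpleGraph V) (G : ColouredGraph W K) (χ : Sym2 W → K)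
    (hχ : ∀ e : G.graph.edgeSet, χ e = G.colour e) :
    G.IsRainbowSaturated H ↔ Saturated H G.graph χ := by
  classical
  unfold ColouredGraph.IsRainbowSaturated Saturated
  rw [hasRainbowCopy_iff H G χ hχ]
  refine and_congr Iff.rfl ?_
  refine forall_congr' fun x => forall_congr' fun y => forall_congr' fun hxy =>
    forall_congr' fun hn => forall_congr' fun i => ?_
  rw [hasRainbowCopy_iff H (G.addEdge x y i) (update χ s(x, y) i)]
  · rw [show (G.addEdge x y i).graph = G.graph ⊔ SimpleGraph.edge x y from rfl]
  · rintro ⟨e, he⟩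
    by_cases h : e ∈ G.graph.edgeSet
    · have hne : e ≠ s(x, y) := by
        rintro rfl
        exact hn h
      simp [ColouredGraph.addEdge, h, update_of_ne hne, ← hχ ⟨e, h⟩]
    · have : e = s(x, y) := by
        induction e with | _ a b =>
        have he' : (G.graph ⊔ SimpleGraph.edge x y).Adj a b := he
        rw [SimpleGraph.sup_adj, SimpleGraph.edge_adj] at he'
        rcases he' with h' | h'
        · exact absurd h' h
        · rcases h'.1 with ⟨rfl, rfl⟩ | ⟨rfl, rfl⟩
          · rfl
          · exact Sym2.eq_swap
      subst this
      simp only [ColouredGraph.addEdge]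
      rw [dif_neg h]
      simp

theorem RainbowIn.mono {H : SimpleGraph V} {G G' : SimpleGraph W} {χ χ' : Sym2 W → K}
    (h : RainbowIn H G χ) (hG : G ≤ G') (hχ : ∀ e ∈ G.edgeSet, χ' e = χ e) :
    RainbowIn H G' χ' := by
  obtain ⟨f, hf, hadj, hinj⟩ := h
  refine ⟨f, hf, fun a b hab => hG (hadj a b hab), ?_⟩
  refine hinj.congr ?_
  intro e he
  induction e with | _ a b =>
  exact (hχ _ (hadj a b he)).symm

/-- Among rainbow-free extensions that keep the colours of `G`, one with a maximal graph is
saturated: a non-edge that could be added harmlessly in some colour would contradict maximality. -/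
theorem exists_saturated_extension [Finite W] [Finite K] (H : SimpleGraph V) (G : SimpleGraph W)
    (χ : Sym2 W → K) (h : ¬ RainbowIn H G χ) :
    ∃ (G' : SimpleGraph W) (χ' : Sym2 W → K), G ≤ G' ∧ (∀ e ∈ G.edgeSet, χ' e = χ e) ∧
      Saturated H G' χ' := by
  classical
  let S : Set (SimpleGraph W × (Sym2 W → K)) :=
    {p | G ≤ p.1 ∧ (∀ e ∈ G.edgeSet, p.2 e = χ e) ∧ ¬ RainbowIn H p.1 p.2}
  obtain ⟨⟨G', χ'⟩, ⟨h1, h2, h3⟩, hmax⟩ :=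
    (Set.toFinite S).exists_maximalFor (fun p => p.1) S ⟨(G, χ), le_rfl, fun _ _ => rfl, h⟩
  refine ⟨G', χ', h1, h2, h3, fun x y hxy hn i => ?_⟩
  by_contra hcon
  have hmem : (G' ⊔ SimpleGraph.edge x y, update χ' s(x, y) i) ∈ S := by
    refine ⟨h1.trans le_sup_left, fun e he => ?_, by convert hcon⟩
    have hne : e ≠ s(x, y) := by
      rintro rfl
      exact hn (h1 he)
    change update χ' s(x, y) i e = _
    rw [update_of_ne hne]
    exact h2 e he
  have hle := hmax hmem le_sup_left
  exact hn (hle (Or.inr ((SimpleGraph.edge_adj ..).2 ⟨Or.inl ⟨rfl, rfl⟩, hxy⟩)))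

theorem ncard_edgeSet_le_mul [Fintype W] (G : SimpleGraph W) (C : ℕ) (F : W → Finset W)
    (hF : ∀ x, (F x).card ≤ C) (hcov : ∀ x y, G.Adj x y → y ∈ F x ∨ x ∈ F y) :
    G.edgeSet.ncard ≤ C * Fintype.card W := by
  classical
  have hsub : G.edgeSet ⊆
      ((Finset.univ.biUnion fun x => (F x).image fun y => s(x, y) : Finset (Sym2 W)) :
        Set (Sym2 W)) := by
    intro e he
    induction e with | _ x y =>
    simp only [Finset.coe_biUnion, Set.mem_iUnion, Finset.coe_image, Set.mem_image]
    rcases hcov x y he with h | h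
    · exact ⟨x, by simp, y, h, rfl⟩
    · exact ⟨y, by simp, x, h, Sym2.eq_swap⟩
  calc G.edgeSet.ncard ≤ _ := Set.ncard_le_ncard hsub (Finset.finite_toSet _)
    _ = _ := Set.ncard_coe_finset _
    _ ≤ ∑ x : W, ((F x).image fun y => s(x, y)).card := Finset.card_biUnion_le
    _ ≤ ∑ x : W, C := Finset.sum_le_sum fun x _ => Finset.card_image_le.trans (hF x)
    _ = _ := by simp [mul_comm]

theorem RainbowIn.of_comap {H : SimpleGraph V} (g : W ≃ W') {G : SimpleGraph W'}
    {χ : Sym2 W' → K} (h : RainbowIn H (G.comap g) (fun e => χ (e.map g))) :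
    RainbowIn H G χ := by
  obtain ⟨f, hf, hadj, hinj⟩ := h
  refine ⟨g ∘ f, g.injective.comp hf, hadj, ?_⟩
  simpa only [Sym2.map_map] using hinj

theorem RainbowIn.comap {H : SimpleGraph V} (g : W ≃ W') {G : SimpleGraph W'}
    {χ : Sym2 W' → K} (h : RainbowIn H G χ) :
    RainbowIn H (G.comap g) (fun e => χ (e.map g)) := by
  obtain ⟨f, hf, hadj, hinj⟩ := h
  refine ⟨g.symm ∘ f, g.symm.injective.comp hf, fun a b hab => by simpa using hadj a b hab, ?_⟩
  have : (g ∘ g.symm ∘ f) = f := by ext; simp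
  simpa only [Sym2.map_map, this] using hinj

theorem Saturated.comap {H : SimpleGraph V} (g : W ≃ W') {G : SimpleGraph W'}
    {χ : Sym2 W' → K} (h : Saturated H G χ) :
    Saturated H (G.comap g) (fun e => χ (e.map g)) := by
  classical
  refine ⟨fun hr => h.1 (hr.of_comap g), fun x y hxy hn i => ?_⟩
  have := (h.2 (g x) (g y) (g.injective.ne hxy) hn i).comap g
  refine this.mono ?_ ?_
  · intro a b hab
    simp only [SimpleGraph.comap_adj, SimpleGraph.sup_adj, SimpleGraph.edge_adj,
      EmbeddingLike.apply_eq_iff_eq, ne_eq] at hab ⊢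
    exact hab
  · intro e _
    by_cases he : e = s(x, y)
    · subst he; simp
    · have : e.map g ≠ s(g x, g y) := by
        rw [← Sym2.map_mk]
        exact (Sym2.map.injective g.injective).ne he
      rw [update_of_ne he, update_of_ne this]

theorem rainbowSat_le [Fintype W] {H : SimpleGraph V} {t : ℕ} {G : SimpleGraph W}
    {χ : Sym2 W → Fin t} (h : Saturated H G χ) :
    rainbowSat H t (Fintype.card W) ≤ G.edgeSet.ncard := by
  let g : Fin (Fintype.card W) ≃ W := (Fintype.equivFin W).symm
  refine Nat.sInf_le ⟨⟨G.comap g, fun e => χ (e.1.map g)⟩, ?_, ?_⟩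
  · exact (isRainbowSaturated_iff H _ (fun e => χ (e.map g)) fun _ => rfl).2 (h.comap g)
  · exact Nat.card_congr (SimpleGraph.Iso.comap g G).mapEdgeSet

/-- In a saturated extension every edge is covered by some `F x`. The quantifier over `χ'` reflects
that the extension chooses the colours of pairs outside `G`. -/
theorem rainbowSat_le_mul [Fintype W] {H : SimpleGraph V} {t : ℕ} {G : SimpleGraph W}
    {χ : Sym2 W → Fin t} (h : ¬ RainbowIn H G χ) (C : ℕ) (F : W → Finset W)
    (hF : ∀ x, (F x).card ≤ C)
    (hcov : ∀ x y, x ≠ y → y ∉ F x → x ∉ F y → ¬ G.Adj x y ∧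
      ∀ (χ' : Sym2 W → Fin t), (∀ e ∈ G.edgeSet, χ' e = χ e) →
        RainbowIn H (G ⊔ SimpleGraph.edge x y) χ') :
    rainbowSat H t (Fintype.card W) ≤ C * Fintype.card W := by
  obtain ⟨G', χ', hle, hχ, hsat⟩ := exists_saturated_extension H G χ h
  refine (rainbowSat_le hsat).trans (ncard_edgeSet_le_mul G' C F hF ?_)
  intro x y hxy
  by_contra! hcon
  obtain ⟨hn, hr⟩ := hcov x y hxy.ne hcon.1 hcon.2
  refine hsat.1 ((hr χ' hχ).mono ?_ fun _ _ => rfl)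
  refine sup_le hle ?_
  intro a b hab
  rw [SimpleGraph.edge_adj] at hab
  rcases hab.1 with ⟨rfl, rfl⟩ | ⟨rfl, rfl⟩
  · exact hxy
  · exact hxy.symm

/-- Extending the empty graph shows that the infimum is over a nonempty set, hence attained rather
than the default value `0`. -/
theorem exists_saturated_ncard_eq (H : SimpleGraph V) {a b : V} (hab : H.Adj a b) {t : ℕ}
    (ht : 0 < t) (n : ℕ) :
    ∃ (G : SimpleGraph (Fin n)) (χ : Sym2 (Fin n) → Fin t),
      Saturated H G χ ∧ G.edgeSet.ncard = rainbowSat H t n := by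
  classical
  have hne : {m : ℕ | ∃ G : ColouredGraph (Fin n) (Fin t),
      G.IsRainbowSaturated H ∧ G.graph.edgeSet.ncard = m}.Nonempty := by
    obtain ⟨G, χ, -, -, h⟩ := exists_saturated_extension H (⊥ : SimpleGraph (Fin n))
      (fun _ => (⟨0, ht⟩ : Fin t)) (by
        rintro ⟨f, -, hf, -⟩
        exact hf a b hab)
    exact ⟨_, ⟨G, fun e => χ e.1⟩, (isRainbowSaturated_iff H _ χ fun _ => rfl).2 h, rfl⟩
  obtain ⟨G, hG, hm⟩ := Nat.sInf_mem hne
  refine ⟨G.graph, fun e => if h : e ∈ G.graph.edgeSet then G.colour ⟨e, h⟩ else ⟨0, ht⟩, ?_, hm⟩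
  refine (isRainbowSaturated_iff H G _ ?_).1 hG
  rintro ⟨e, he⟩
  simp [he]

end Basics

/-! ### Lower bounds: random vertex colourings and avoidable colours -/

section LowerBounds

variable {V W K T : Type*}

/-- A copy that missed the new edge would already be in `G`. The conclusion is stated through `χ`
alone, without the updated colouring. -/
theorem Saturated.exists_copy_through {H : SimpleGraph V} {G : SimpleGraph W} {χ : Sym2 W → K}
    (h : Saturated H G χ) {x y : W} (hxy : x ≠ y) (hn : ¬ G.Adj x y) (i : K) :
    ∃ (f : V → W) (a b : V), Injective f ∧ H.Adj a b ∧ f a = x ∧ f b = y ∧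
      (∀ c d, H.Adj c d → s(c, d) ≠ s(a, b) → G.Adj (f c) (f d)) ∧
      Set.InjOn (fun e : Sym2 V => χ (e.map f)) (H.edgeSet \ {s(a, b)}) ∧
      ∀ e ∈ H.edgeSet, e ≠ s(a, b) → χ (e.map f) ≠ i := by
  classical
  obtain ⟨f, hf, hadj, hinj⟩ := h.2 x y hxy hn i
  have key : ∃ a b, H.Adj a b ∧ f a = x ∧ f b = y := by
    by_contra! hcon
    have hne : ∀ e ∈ H.edgeSet, e.map f ≠ s(x, y) := by
      intro e he heq
      induction e with | _ a b =>
      rcases Sym2.eq_iff.1 heq with ⟨h1, h2⟩ | ⟨h1, h2⟩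
      · exact hcon a b he h1 h2
      · exact hcon b a (SimpleGraph.Adj.symm he) h2 h1
    refine h.1 ⟨f, hf, fun a b hab => ?_, ?_⟩
    · rcases hadj a b hab with h1 | h1
      · exact h1
      · rw [SimpleGraph.edge_adj] at h1
        refine absurd ?_ (hne s(a, b) hab)
        rcases h1.1 with ⟨rfl, rfl⟩ | ⟨rfl, rfl⟩
        · rfl
        · exact Sym2.eq_swap
    · refine hinj.congr fun e he => ?_
      simp only
      rw [update_of_ne (hne e he)]
  obtain ⟨a, b, hab, rfl, rfl⟩ := key
  have hne : ∀ e : Sym2 V, e ≠ s(a, b) → e.map f ≠ s(f a, f b) := fun e he => by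
    rw [← Sym2.map_mk]
    exact (Sym2.map.injective hf).ne he
  refine ⟨f, a, b, hf, hab, rfl, rfl, fun c d hcd hne' => ?_, ?_, ?_⟩
  · rcases hadj c d hcd with h1 | h1
    · exact h1
    · rw [SimpleGraph.edge_adj] at h1
      refine absurd ?_ (hne _ hne')
      rcases h1.1 with ⟨h2, h3⟩ | ⟨h2, h3⟩
      · rw [Sym2.map_mk, h2, h3]
      · rw [Sym2.map_mk, h2, h3]
        exact Sym2.eq_swap
  · refine (hinj.mono Set.sdiff_subset).congr fun e he => ?_
    simp only
    rw [update_of_ne (hne e he.2)]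
  · intro e he hne' hi
    refine hne' (hinj he (show s(a, b) ∈ H.edgeSet from hab) ?_)
    simp only [Sym2.map_mk, update_self]
    rw [update_of_ne (hne e hne'), hi]

theorem exists_adj_of_connected [Finite V] {H : SimpleGraph V} (hconn : H.Connected)
    (hcard : 3 ≤ Nat.card V) (a b : V) : ∃ c, c ≠ a ∧ c ≠ b ∧ (H.Adj a c ∨ H.Adj b c) := by
  classical
  have := Fintype.ofFinite V
  by_contra! hcon
  have hreach : ∀ c, H.Reachable a c → c = a ∨ c = b := by
    rintro c ⟨p⟩
    have : ∀ (d c : V), (d = a ∨ d = b) → H.Walk d c → c = a ∨ c = b := by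
      intro d c hd p
      induction p with
      | nil => exact hd
      | @cons u v w huv p ih =>
        refine ih ?_
        by_contra! hv
        rcases hd with rfl | rfl
        · exact (hcon v hv.1 hv.2).1 huv
        · exact (hcon v hv.1 hv.2).2 huv
    exact this a c (Or.inl rfl) p
  have hsub : (Finset.univ : Finset V) ⊆ {a, b} := fun c _ => by
    simpa using hreach c (hconn.preconnected a c)
  have h1 := Finset.card_le_card hsub
  have h2 := Finset.card_le_two (a := a) (b := b)
  rw [Nat.card_eq_fintype_card] at hcard
  rw [Finset.card_univ] at h1
  omega

/-- Two isolated vertices cannot coexist: joining them must create a copy of `H`, in which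
connectedness gives a further edge at one of them. -/
theorem Saturated.card_le_two_mul_add_one [Finite V] [Fintype W] [Nonempty K] {H : SimpleGraph V}
    (hconn : H.Connected) (hcard : 3 ≤ Nat.card V) {G : SimpleGraph W} {χ : Sym2 W → K}
    (h : Saturated H G χ) : Fintype.card W ≤ 2 * G.edgeSet.ncard + 1 := by
  classical
  have hiso : (Finset.univ.filter fun x => G.degree x = 0).card ≤ 1 := by
    rw [Finset.card_le_one]
    intro x hx y hy
    by_contra hxy
    simp only [Finset.mem_filter, Finset.mem_univ, true_and] at hx hy
    have hx' : ∀ z, ¬ G.Adj x z := fun z hz =>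
      (SimpleGraph.degree_pos_iff_exists_adj _ _).2 ⟨z, hz⟩ |>.ne' hx
    have hy' : ∀ z, ¬ G.Adj y z := fun z hz =>
      (SimpleGraph.degree_pos_iff_exists_adj _ _).2 ⟨z, hz⟩ |>.ne' hy
    obtain ⟨f, a, b, hf, hab, rfl, rfl, hadj, -, -⟩ :=
      h.exists_copy_through hxy (hx' y) (Classical.arbitrary K)
    obtain ⟨c, hca, hcb, hc⟩ := exists_adj_of_connected hconn hcard a b
    rcases hc with hc | hc
    · refine hx' _ (hadj a c hc fun h => ?_)
      rcases Sym2.eq_iff.1 h with ⟨-, h⟩ | ⟨h, -⟩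
      · exact hcb h
      · exact hab.ne h
    · refine hy' _ (hadj b c hc fun h => ?_)
      rcases Sym2.eq_iff.1 h with ⟨h, -⟩ | ⟨-, h⟩
      · exact hab.ne' h
      · exact hca h
  have hsum := G.sum_degrees_eq_twice_card_edges
  rw [Set.ncard_eq_toFinset_card', show G.edgeSet.toFinset = G.edgeFinset from rfl, ← hsum]
  have h2 := Finset.card_filter_add_card_filter_not (s := (Finset.univ : Finset W))
    (fun x => G.degree x = 0)
  rw [Finset.card_univ] at h2
  have h3 : (Finset.univ.filter fun x => ¬ G.degree x = 0).card ≤ ∑ x, G.degree x := by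
    rw [Finset.card_filter]
    refine Finset.sum_le_sum fun x _ => ?_
    split_ifs <;> omega
  omega

/-- Choose `φ : W → K` at random and keep a low-degree vertex `x` if `φ z` is the colour of `xz` for
each neighbour `z`. Kept vertices with equal labels are adjacent, so each label keeps at most `D +
1`, while each low-degree vertex survives with probability at least `|K| ^ (-D)`. -/
theorem card_filter_degree_le [Fintype W] [DecidableEq W] [Fintype K] [DecidableEq K] [Fintype T]
    [DecidableEq T] (G : SimpleGraph W) [DecidableRel G.Adj] (χ : Sym2 W → K) (A : W → T)
    (hA : ∀ x y, x ≠ y → ¬ G.Adj x y → A x = A y →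
      ∃ z, G.Adj x z ∧ G.Adj y z ∧ χ s(x, z) ≠ χ s(y, z))
    (hK : 0 < Fintype.card K) (D : ℕ) (hD : D ≤ Fintype.card W) :
    (Finset.univ.filter fun x => G.degree x ≤ D).card ≤
      Fintype.card T * (D + 1) * Fintype.card K ^ D := by
  set L := Finset.univ.filter fun x => G.degree x ≤ D with hL
  set t := Fintype.card K
  have hφ : ∀ φ : W → K,
      (L.filter fun x => ∀ z, G.Adj x z → φ z = χ s(x, z)).card ≤ Fintype.card T * (D + 1) := by
    intro φ
    set S := L.filter fun x => ∀ z, G.Adj x z → φ z = χ s(x, z) with hS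
    have := Finset.card_le_mul_card_image_of_maps_to (s := S) (t := (Finset.univ : Finset T))
      (f := A) (fun _ _ => Finset.mem_univ _) (D + 1) ?_
    · rwa [Finset.card_univ, mul_comm] at this
    · intro τ _
      rcases (S.filter fun x => A x = τ).eq_empty_or_nonempty with he | ⟨x, hx⟩
      · simp [he]
      have hsub : (S.filter fun x => A x = τ) ⊆ insert x (G.neighborFinset x) := by
        intro y hy
        rw [Finset.mem_insert, SimpleGraph.mem_neighborFinset]
        by_contra! hcon
        rw [Finset.mem_filter, hS, Finset.mem_filter] at hx hy
        obtain ⟨z, h1, h2, h3⟩ := hA x y hcon.1.symm hcon.2 (hx.2.trans hy.2.symm)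
        exact h3 ((hx.1.2 z h1).symm.trans (hy.1.2 z h2))
      refine (Finset.card_le_card hsub).trans ((Finset.card_insert_le _ _).trans ?_)
      rw [SimpleGraph.card_neighborFinset_eq_degree]
      rw [Finset.mem_filter, hS, Finset.mem_filter, hL, Finset.mem_filter] at hx
      omega
  -- The values of `φ` are prescribed on at most `D` neighbours and free elsewhere.
  have hcount : ∀ x ∈ L, t ^ (Fintype.card W - D) ≤
      (Finset.univ.filter fun φ : W → K => ∀ z, G.Adj x z → φ z = χ s(x, z)).card := by
    intro x hx
    have : (Finset.univ.filter fun φ : W → K => ∀ z, G.Adj x z → φ z = χ s(x, z)) =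
        Fintype.piFinset fun z => if G.Adj x z then {χ s(x, z)} else Finset.univ := by
      ext φ
      simp only [Finset.mem_filter, Finset.mem_univ, true_and, Fintype.mem_piFinset]
      refine forall_congr' fun z => ?_
      split_ifs with h <;> simp [h]
    rw [this, Fintype.card_piFinset]
    have h2 : ∀ z, (if G.Adj x z then ({χ s(x, z)} : Finset K) else Finset.univ).card =
        if G.Adj x z then 1 else t := by
      intro z
      split_ifs <;> simp [t]
    simp_rw [h2]
    rw [Finset.prod_ite, Finset.prod_const_one, one_mul, Finset.prod_const]
    refine Nat.pow_le_pow_right hK ?_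
    have h3 := Finset.card_filter_add_card_filter_not (s := (Finset.univ : Finset W))
      (fun z => G.Adj x z)
    rw [← SimpleGraph.neighborFinset_eq_filter, SimpleGraph.card_neighborFinset_eq_degree,
      Finset.card_univ] at h3
    have h4 : G.degree x ≤ D := (Finset.mem_filter.1 hx).2
    omega
  have hdouble : L.card * t ^ (Fintype.card W - D) ≤
      t ^ Fintype.card W * (Fintype.card T * (D + 1)) := by
    calc L.card * t ^ (Fintype.card W - D)
        ≤ ∑ x ∈ L, (Finset.univ.filter fun φ : W → K =>
            ∀ z, G.Adj x z → φ z = χ s(x, z)).card := by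
          rw [← smul_eq_mul]
          exact Finset.card_nsmul_le_sum _ _ _ hcount
      _ = ∑ φ : W → K, (L.filter fun x => ∀ z, G.Adj x z → φ z = χ s(x, z)).card :=
          Finset.sum_card_bipartiteAbove_eq_sum_card_bipartiteBelow
            (r := fun x (φ : W → K) => ∀ z, G.Adj x z → φ z = χ s(x, z))
      _ ≤ ∑ _φ : W → K, Fintype.card T * (D + 1) := Finset.sum_le_sum fun φ _ => hφ φ
      _ = _ := by simp [t]
  have hpos : 0 < t ^ (Fintype.card W - D) := pow_pos hK _
  refine Nat.le_of_mul_le_mul_right (hdouble.trans_eq ?_) hpos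
  rw [mul_assoc _ (t ^ D), ← pow_add, Nat.add_sub_cancel' hD, mul_comm]

theorem sub_card_filter_degree_mul_le [Fintype W] [DecidableEq W] (G : SimpleGraph W)
    [DecidableRel G.Adj] (D : ℕ) :
    (Fintype.card W - (Finset.univ.filter fun x => G.degree x ≤ D).card) * (D + 1) ≤
      2 * G.edgeSet.ncard := by
  rw [Set.ncard_eq_toFinset_card', show G.edgeSet.toFinset = G.edgeFinset from rfl,
    ← G.sum_degrees_eq_twice_card_edges]
  have h2 := Finset.card_filter_add_card_filter_not (s := (Finset.univ : Finset W))
    (fun x => G.degree x ≤ D)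
  rw [Finset.card_univ] at h2
  rw [← h2, Nat.add_sub_cancel_left, ← smul_eq_mul]
  refine (Finset.card_nsmul_le_sum _ (fun x => G.degree x) _ ?_).trans
    (Finset.sum_le_sum_of_subset (Finset.filter_subset _ _))
  intro x hx
  have := (Finset.mem_filter.1 hx).2
  omega

/-- The label classes are cliques; apply Cauchy–Schwarz to their sizes and bound the class of `x` by
`deg x + 1`. -/
theorem sq_card_le_of_label [Fintype W] [Fintype T] (G : SimpleGraph W) (A : W → T)
    (hA : ∀ x y, x ≠ y → A x = A y → G.Adj x y) :
    Fintype.card W ^ 2 ≤ Fintype.card T * (2 * G.edgeSet.ncard + Fintype.card W) := by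
  classical
  have h1 : ∑ τ : T, (Finset.univ.filter fun x => A x = τ).card = Fintype.card W :=
    (Finset.card_eq_sum_card_fiberwise fun x _ => Finset.mem_univ (A x)).symm
  have h2 := sq_sum_le_card_mul_sum_sq (s := (Finset.univ : Finset T))
    (f := fun τ => (Finset.univ.filter fun x => A x = τ).card)
  rw [h1, Finset.card_univ] at h2
  refine h2.trans (Nat.mul_le_mul_left _ ?_)
  rw [Set.ncard_eq_toFinset_card', show G.edgeSet.toFinset = G.edgeFinset from rfl,
    ← G.sum_degrees_eq_twice_card_edges]
  calc ∑ τ : T, (Finset.univ.filter fun x => A x = τ).card ^ 2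
      = ∑ τ : T, ∑ x ∈ Finset.univ.filter fun x => A x = τ,
          (Finset.univ.filter fun y => A y = A x).card := by
        refine Finset.sum_congr rfl fun τ _ => ?_
        rw [sq, ← smul_eq_mul, ← Finset.sum_const]
        refine Finset.sum_congr rfl fun x hx => ?_
        rw [(Finset.mem_filter.1 hx).2]
    _ = ∑ x : W, (Finset.univ.filter fun y => A y = A x).card :=
        Finset.sum_fiberwise _ _ _
    _ ≤ ∑ x : W, (G.degree x + 1) := by
        refine Finset.sum_le_sum fun x _ => ?_
        have hsub : (Finset.univ.filter fun y => A y = A x) ⊆ insert x (G.neighborFinset x) := by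
          intro y hy
          rw [Finset.mem_insert, SimpleGraph.mem_neighborFinset]
          by_cases h : y = x
          · exact Or.inl h
          · exact Or.inr (hA x y (Ne.symm h) (Finset.mem_filter.1 hy).2.symm)
        refine (Finset.card_le_card hsub).trans ((Finset.card_insert_le _ _).trans ?_)
        rw [SimpleGraph.card_neighborFinset_eq_degree]
    _ = _ := by simp [Finset.sum_add_distrib]

/-- `x` is the image of `v` in a rainbow copy of `H` minus a leaf at `v` that avoids the
colour `i`. -/
def AvoidsAt (H : SimpleGraph V) (v : V) (G : SimpleGraph W) (χ : Sym2 W → K) (x : W) (i : K) :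
    Prop :=
  ∃ (f : V → W) (b : V), b ≠ v ∧ (∀ z, H.Adj b z → z = v) ∧ f v = x ∧ Set.InjOn f {b}ᶜ ∧
    (∀ c d, H.Adj c d → c ≠ b → d ≠ b → G.Adj (f c) (f d)) ∧
    Set.InjOn (fun e : Sym2 V => χ (e.map f)) {e ∈ H.edgeSet | b ∉ e} ∧
    ∀ e ∈ H.edgeSet, b ∉ e → χ (e.map f) ≠ i

/-- If every colour were avoidable at `x`, take an edge of one such copy at `x`, of colour `j`, and
attach it as the missing leaf to a copy that avoids `j`: this is a rainbow `H`. -/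
theorem exists_not_avoidsAt [Finite V] [Nonempty K] {H : SimpleGraph V} (hcard : 3 ≤ Nat.card V)
    {v : V} (hv : ∀ w, w ≠ v → H.Adj v w) {G : SimpleGraph W} {χ : Sym2 W → K}
    (hfree : ¬ RainbowIn H G χ) (x : W) : ∃ i, ¬ AvoidsAt H v G χ x i := by
  classical
  have := Fintype.ofFinite V
  by_contra! hall
  obtain ⟨f₀, b₀, hb₀, -, hf₀, hinj₀, hadj₀, -, -⟩ := hall (Classical.arbitrary K)
  obtain ⟨z, hz⟩ : ∃ z, z ∉ ({v, b₀} : Finset V) := by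
    by_contra! h
    have h1 := Finset.card_le_card (fun z _ => h z : (Finset.univ : Finset V) ⊆ {v, b₀})
    have h2 := Finset.card_le_two (a := v) (b := b₀)
    rw [Nat.card_eq_fintype_card] at hcard
    rw [Finset.card_univ] at h1
    omega
  simp only [Finset.mem_insert, Finset.mem_singleton, not_or] at hz
  set j := χ s(x, f₀ z) with hj
  have hxz : G.Adj x (f₀ z) := hf₀ ▸ hadj₀ v z (hv z hz.1) hb₀.symm hz.2
  obtain ⟨f, b, hb, hleaf, hfv, hinj, hadj, hrain, havoid⟩ := hall j
  -- As `v` is conical, if `f₀ z` were in the copy then so would be its edge to `x`, of the avoided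
  -- colour `j`.
  have hnew : ∀ d, d ≠ b → f d ≠ f₀ z := by
    intro d hd hfd
    have hdv : d ≠ v := by
      rintro rfl
      rw [hfv] at hfd
      exact hxz.ne hfd
    refine havoid s(v, d) (hv d hdv) ?_ ?_
    · simp [hb, hd.symm]
    · rw [Sym2.map_mk, hfv, hfd]
  have hedge : ∀ e ∈ H.edgeSet, b ∈ e → e = s(v, b) := by
    intro e he hbe
    obtain ⟨d, rfl⟩ := hbe
    rw [hleaf d he]
    exact Sym2.eq_swap
  have hmap : ∀ e : Sym2 V, b ∉ e → e.map (update f b (f₀ z)) = e.map f := by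
    intro e he
    refine Sym2.map_congr fun d hd => ?_
    rw [update_of_ne]
    rintro rfl
    exact he hd
  have hmapb : (s(v, b)).map (update f b (f₀ z)) = s(x, f₀ z) := by
    rw [Sym2.map_mk, update_self, update_of_ne hb.symm, hfv]
  refine hfree ⟨update f b (f₀ z), ?_, ?_, ?_⟩
  · intro c d hcd
    by_cases hc : c = b <;> by_cases hd : d = b
    · rw [hc, hd]
    · subst hc
      rw [update_self, update_of_ne hd] at hcd
      exact absurd hcd.symm (hnew d hd)
    · subst hd
      rw [update_self, update_of_ne hc] at hcd
      exact absurd hcd (hnew c hc)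
    · rw [update_of_ne hc, update_of_ne hd] at hcd
      exact hinj hc hd hcd
  · intro c d hcd
    by_cases hbe : b ∈ s(c, d)
    · have h1 := hedge _ hcd hbe
      have h2 : s(update f b (f₀ z) c, update f b (f₀ z) d) = s(x, f₀ z) := by
        rw [← hmapb, ← h1, Sym2.map_mk]
      rw [← SimpleGraph.mem_edgeSet, h2]
      exact hxz
    · have h2 := hmap _ hbe
      rw [Sym2.map_mk, Sym2.map_mk] at h2
      rw [← SimpleGraph.mem_edgeSet, h2]
      simp only [Sym2.mem_iff, not_or] at hbe
      exact hadj c d hcd (Ne.symm hbe.1) (Ne.symm hbe.2)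
  · intro e he e' he' heq
    simp only at heq
    by_cases hbe : b ∈ e <;> by_cases hbe' : b ∈ e'
    · rw [hedge e he hbe, hedge e' he' hbe']
    · rw [hedge e he hbe, hmapb, hmap e' hbe', ← hj] at heq
      exact absurd heq.symm (havoid e' he' hbe')
    · rw [hedge e' he' hbe', hmapb, hmap e hbe, ← hj] at heq
      exact absurd heq (havoid e he hbe)
    · rw [hmap e hbe, hmap e' hbe'] at heq
      exact hrain ⟨he, hbe⟩ ⟨he', hbe'⟩ heq

theorem Saturated.exists_common_neighbour_of_triangle {H : SimpleGraph V} {G : SimpleGraph W}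
    {χ : Sym2 W → K} {f : V → W} {a b c : V}
    (hadj : ∀ c d, H.Adj c d → s(c, d) ≠ s(a, b) → G.Adj (f c) (f d))
    (hinj : Set.InjOn (fun e : Sym2 V => χ (e.map f)) (H.edgeSet \ {s(a, b)}))
    (hab : H.Adj a b) (hac : H.Adj a c) (hbc : H.Adj b c) :
    ∃ z, G.Adj (f a) z ∧ G.Adj (f b) z ∧ χ s(f a, z) ≠ χ s(f b, z) := by
  have h1 : s(a, c) ≠ s(a, b) := by simp [hbc.ne', hab.ne]
  have h2 : s(b, c) ≠ s(a, b) := by simp [hab.ne', hac.ne']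
  refine ⟨f c, hadj a c hac h1, hadj b c hbc h2, fun h => ?_⟩
  have := hinj ⟨hac, h1⟩ ⟨hbc, h2⟩ h
  rcases Sym2.eq_iff.1 this with ⟨h, -⟩ | ⟨h, -⟩
  · exact hab.ne h
  · exact hac.ne h

/-- Add `xy` in a colour avoidable at neither end. If the edge of `H` mapped to `xy` were in no
triangle, it would join the conical vertex to a leaf, and the rest of the copy would show the colour
avoidable at `x` or `y`. -/
theorem Saturated.exists_common_neighbour_of_conical [Finite V] [Nonempty K] {H : SimpleGraph V}
    (hcard : 3 ≤ Nat.card V) {v : V} (hv : ∀ w, w ≠ v → H.Adj v w) {G : SimpleGraph W}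
    {χ : Sym2 W → K} (h : Saturated H G χ) {x y : W} (hxy : x ≠ y) (hn : ¬ G.Adj x y)
    (hA : {i | AvoidsAt H v G χ x i} = {i | AvoidsAt H v G χ y i}) :
    (∃ z, G.Adj x z ∧ G.Adj y z ∧ χ s(x, z) ≠ χ s(y, z)) ∧
      ∃ a b c, H.Adj a b ∧ H.Adj a c ∧ H.Adj b c := by
  obtain ⟨i, hi⟩ := exists_not_avoidsAt hcard hv h.1 x
  have hi' : ¬ AvoidsAt H v G χ y i := fun h => hi (by
    change i ∈ {i | AvoidsAt H v G χ x i}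
    rw [hA]
    exact h)
  obtain ⟨f, a, b, hf, hab, rfl, rfl, hadj, hinj, havoid⟩ := h.exists_copy_through hxy hn i
  by_cases htri : ∃ c, H.Adj a c ∧ H.Adj b c
  · obtain ⟨c, hac, hbc⟩ := htri
    exact ⟨exists_common_neighbour_of_triangle hadj hinj hab hac hbc, a, b, c, hab, hac, hbc⟩
  exfalso
  have hne : ∀ e : Sym2 V, b ∉ e → e ≠ s(a, b) := by
    rintro e he rfl
    simp at he
  have hne' : ∀ e : Sym2 V, a ∉ e → e ≠ s(a, b) := by
    rintro e he rfl
    simp at he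
  by_cases hav : a = v
  · subst hav
    refine hi ⟨f, b, hab.ne', fun z hz => ?_, rfl, hf.injOn, fun c d hcd hc hd => ?_,
      hinj.mono (by exact fun e he => ⟨he.1, hne e he.2⟩), fun e he hbe => havoid e he (hne e hbe)⟩
    · by_contra hza
      exact htri ⟨z, hv z hza, hz⟩
    · exact hadj c d hcd (hne _ (by simp [hc.symm, hd.symm]))
  by_cases hbv : b = v
  · subst hbv
    refine hi' ⟨f, a, hab.ne, fun z hz => ?_, rfl, hf.injOn, fun c d hcd hc hd => ?_,
      hinj.mono (by exact fun e he => ⟨he.1, hne' e he.2⟩), fun e he hbe => havoid e he (hne' e hbe)⟩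
    · by_contra hza
      exact htri ⟨z, hz, hv z hza⟩
    · exact hadj c d hcd (hne' _ (by simp [hc.symm, hd.symm]))
  · exact htri ⟨v, (hv a hav).symm, (hv b hbv).symm⟩

end LowerBounds

/-! ### Folds of `H` onto `H / uv` and their impossibility -/

section Fold

variable {V : Type*}

/-- The data that a rainbow copy of `H` induces when it lives in copies of `H / uv` whose edges are
recoloured: `ψ` is the projection to `H / uv` (with `u` for the contracted edge), `kind e` is the
edge of `H` over which `e` lies, and `var e` is the edge recoloured in the copy containing `e`. -/
structure IsFold [DecidableEq V] (H : SimpleGraph V) (u v : V) (ψ : V → V) (vr : V → Sym2 V)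
    (kind var : Sym2 V → Sym2 V) : Prop where
  proj_ne : ∀ a, ψ a ≠ v
  kind_mem : ∀ e ∈ H.edgeSet, kind e ∈ H.edgeSet
  kind_ne : ∀ e ∈ H.edgeSet, kind e ≠ s(u, v)
  map_kind : ∀ e ∈ H.edgeSet, (kind e).map (update id v u) = e.map ψ
  var_eq : ∀ a b, H.Adj a b → ψ a ≠ u → var s(a, b) = vr a
  inj : Set.InjOn (fun e => if kind e = var e then s(u, v) else kind e) H.edgeSet

namespace IsFold

variable [DecidableEq V] {H : SimpleGraph V} {u v : V} {ψ : V → V} {vr : V → Sym2 V}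
  {kind var : Sym2 V → Sym2 V}

theorem special_unique (F : IsFold H u v ψ vr kind var) {e e' : Sym2 V} (he : e ∈ H.edgeSet)
    (he' : e' ∈ H.edgeSet) (h : kind e = var e) (h' : kind e' = var e') : e = e' :=
  F.inj he he' (by simp [h, h'])

theorem kind_inj (F : IsFold H u v ψ vr kind var) {e e' : Sym2 V} (he : e ∈ H.edgeSet)
    (he' : e' ∈ H.edgeSet) (h : kind e ≠ var e) (h' : kind e' ≠ var e')
    (heq : kind e = kind e') : e = e' :=
  F.inj he he' (by simpa only [if_neg h, if_neg h'] using heq)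

/-- Only the edge `uv` collapses under the contraction, and it is never a kind. -/
theorem proj_adj_ne (F : IsFold H u v ψ vr kind var) {x y : V} (hxy : H.Adj x y) :
    ψ x ≠ ψ y := by
  have h1 := F.map_kind s(x, y) hxy
  have h2 := F.kind_mem s(x, y) hxy
  have h3 := F.kind_ne s(x, y) hxy
  generalize kind s(x, y) = k at h1 h2 h3
  induction k with | _ p q =>
  intro heq
  have hpq : H.Adj p q := h2
  have h4 : update id v u p = update id v u q := by
    rw [Sym2.map_mk, Sym2.map_mk] at h1
    rcases Sym2.eq_iff.1 h1 with ⟨h, h'⟩ | ⟨h, h'⟩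
    · rw [h, h', heq]
    · rw [h, h', heq]
  by_cases hp : p = v <;> by_cases hq : q = v
  · exact hpq.ne (hp.trans hq.symm)
  · subst hp
    rw [update_self, update_of_ne hq] at h4
    exact h3 (by rw [h4]; exact Sym2.eq_swap)
  · subst hq
    rw [update_self, update_of_ne hp] at h4
    exact h3 (by rw [← h4]; rfl)
  · rw [update_of_ne hp, update_of_ne hq] at h4
    exact hpq.ne h4

variable [Fintype V]

/-- An injective self-map of a finite set is bijective. Hence exactly one edge is recoloured, and
each edge of `H` except `uv` is the kind of exactly one other edge. -/
theorem surj (F : IsFold H u v ψ vr kind var) (huv : H.Adj u v) {f : Sym2 V} (hf : f ∈ H.edgeSet) :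
    ∃ e ∈ H.edgeSet, (if kind e = var e then s(u, v) else kind e) = f := by
  have hmaps : Set.MapsTo (fun e => if kind e = var e then s(u, v) else kind e)
      H.edgeSet H.edgeSet := by
    intro e he
    simp only
    split_ifs
    · exact huv
    · exact F.kind_mem e he
  exact ((Set.toFinite H.edgeSet).injOn_iff_bijOn_of_mapsTo hmaps).1 F.inj |>.surjOn hf

theorem exists_special (F : IsFold H u v ψ vr kind var) (huv : H.Adj u v) :
    ∃ e ∈ H.edgeSet, kind e = var e := by
  obtain ⟨e, he, h⟩ := F.surj huv (show s(u, v) ∈ H.edgeSet from huv)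
  refine ⟨e, he, ?_⟩
  by_contra hne
  rw [if_neg hne] at h
  exact F.kind_ne e he h

theorem exists_kind (F : IsFold H u v ψ vr kind var) (huv : H.Adj u v) {f : Sym2 V}
    (hf : f ∈ H.edgeSet) (hne : f ≠ s(u, v)) :
    ∃ e ∈ H.edgeSet, kind e = f ∧ kind e ≠ var e := by
  obtain ⟨e, he, h⟩ := F.surj huv hf
  by_cases hk : kind e = var e
  · rw [if_pos hk] at h
    exact absurd h.symm hne
  · rw [if_neg hk] at h
    exact ⟨e, he, h, hk⟩

theorem exists_lift (F : IsFold H u v ψ vr kind var) (huv : H.Adj u v) {p q : V}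
    (hpq : H.Adj p q) (hne : s(p, q) ≠ s(u, v)) :
    ∃ x y, H.Adj x y ∧ ψ x = update id v u p ∧ ψ y = update id v u q ∧
      kind s(x, y) = s(p, q) ∧ kind s(x, y) ≠ var s(x, y) := by
  obtain ⟨e, he, hk, hv⟩ := F.exists_kind huv hpq hne
  have hmap := F.map_kind e he
  rw [hk] at hmap
  induction e with | _ x y =>
  rw [Sym2.map_mk, Sym2.map_mk] at hmap
  rcases Sym2.eq_iff.1 hmap with ⟨h1, h2⟩ | ⟨h1, h2⟩
  · exact ⟨x, y, he, h1.symm, h2.symm, hk, hv⟩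
  · rw [Sym2.eq_swap] at hk hv
    exact ⟨y, x, SimpleGraph.Adj.symm he, h1.symm, h2.symm, hk, hv⟩

/-- Lift an edge at `w` other than `uv`; over the contracted vertex, lift one that leaves the pair
`{u, v}`. -/
theorem proj_surj (F : IsFold H u v ψ vr kind var) (huv : H.Adj u v) (hconn : H.Connected)
    (hcard : 3 ≤ Nat.card V) {w : V} (hw : w ≠ v) : ∃ z, ψ z = w := by
  by_cases hwu : w = u
  · subst hwu
    obtain ⟨c, hcu, hcv, hc⟩ := exists_adj_of_connected hconn hcard w v
    rcases hc with hc | hc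
    · obtain ⟨x, y, -, hx, -⟩ := F.exists_lift huv hc (by simp [hcv, hw])
      exact ⟨x, by simpa [hw] using hx⟩
    · obtain ⟨x, y, -, hx, -⟩ := F.exists_lift huv hc (by simp [hcu, hcv])
      exact ⟨x, by simpa using hx⟩
  · obtain ⟨c, hcw, -, hc⟩ := exists_adj_of_connected hconn hcard w w
    obtain ⟨x, y, -, hx, -⟩ := F.exists_lift huv (or_self_iff.1 hc) (by simp [hw, hwu])
    exact ⟨x, by simpa [hw] using hx⟩

/-- The projection maps `V` onto `V` minus one point, so exactly two vertices are identified. -/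
theorem exists_fibre (F : IsFold H u v ψ vr kind var) (huv : H.Adj u v) (hconn : H.Connected)
    (hcard : 3 ≤ Nat.card V) :
    ∃ a b, a ≠ b ∧ ψ a = ψ b ∧
      ∀ p q, p ≠ q → ψ p = ψ q → (p = a ∧ q = b) ∨ (p = b ∧ q = a) := by
  have hninj : ¬ Injective ψ := by
    intro hinj
    obtain ⟨a, ha⟩ := Finite.surjective_of_injective hinj v
    exact F.proj_ne a ha
  simp only [Injective, not_forall] at hninj
  obtain ⟨a, b, hab, hne⟩ := hninj
  have key : ∀ a b, a ≠ b → ψ a = ψ b → Set.InjOn ψ {a}ᶜ := by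
    intro a b hne hab
    have h1 : (Finset.univ.erase a).image ψ = Finset.univ.erase v := by
      ext w
      simp only [Finset.mem_image, Finset.mem_erase, Finset.mem_univ, and_true]
      constructor
      · rintro ⟨z, -, rfl⟩
        exact F.proj_ne z
      · intro hw
        obtain ⟨z, rfl⟩ := F.proj_surj huv hconn hcard hw
        by_cases hz : z = a
        · subst hz
          exact ⟨b, hne.symm, hab.symm⟩
        · exact ⟨z, hz, rfl⟩
    have h2 : ((Finset.univ.erase a).image ψ).card = (Finset.univ.erase a).card := by
      rw [h1, Finset.card_erase_of_mem (Finset.mem_univ _),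
        Finset.card_erase_of_mem (Finset.mem_univ _)]
    have := Finset.card_image_iff.1 h2
    intro x hx y hy hxy
    exact this (by simpa using hx) (by simpa using hy) hxy
  have hne : a ≠ b := hne
  refine ⟨a, b, hne, hab, fun p q hpq h => ?_⟩
  have h1 : p = a ∨ q = a := by
    by_contra! hcon
    exact hpq (key a b hne hab hcon.1 hcon.2 h)
  have h2 : p = b ∨ q = b := by
    by_contra! hcon
    exact hpq (key b a hne.symm hab.symm hcon.1 hcon.2 h)
  rcases h1 with rfl | rfl <;> rcases h2 with h2 | rfl
  · exact absurd h2 hne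
  · exact Or.inl ⟨rfl, rfl⟩
  · exact Or.inr ⟨h2, rfl⟩
  · exact absurd rfl hne

/-- The centre of the fold: `ca` and `cb` are the only two edges over the same edge of `H / uv`,
and `c` is the only vertex over the contracted vertex. -/
theorem exists_centre (F : IsFold H u v ψ vr kind var) (huv : H.Adj u v) (hconn : H.Connected)
    (hcard : 3 ≤ Nat.card V) :
    ∃ a b c, a ≠ b ∧ H.Adj c a ∧ H.Adj c b ∧ ψ c = u ∧ ψ a = ψ b ∧
      kind s(c, a) = var s(c, a) ∧ kind s(c, b) = kind s(c, a) ∧ kind s(c, b) ≠ var s(c, b) ∧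
      ∀ p q, p ≠ q → ψ p = ψ q → (p = a ∧ q = b) ∨ (p = b ∧ q = a) := by
  obtain ⟨a, b, hab, hψ, huniq⟩ := F.exists_fibre huv hconn hcard
  obtain ⟨e₀, he₀, hs⟩ := F.exists_special huv
  -- Besides the recoloured edge `e₀`, its kind is also attained by an edge `e₁` with its original
  -- colour.
  obtain ⟨e₁, he₁, hk₁, hs₁⟩ := F.exists_kind huv (F.kind_mem e₀ he₀) (F.kind_ne e₀ he₀)
  have hne : e₀ ≠ e₁ := by
    rintro rfl
    exact hs₁ hs
  have hmap : e₀.map ψ = e₁.map ψ := by rw [← F.map_kind e₀ he₀, ← F.map_kind e₁ he₁, hk₁]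
  have hform : ∃ c a' b', e₀ = s(c, a') ∧ e₁ = s(c, b') ∧ ψ a' = ψ b' ∧ a' ≠ b' := by
    induction e₀ with | _ x y =>
    obtain ⟨x', y', rfl, hx, hy⟩ : ∃ x' y', e₁ = s(x', y') ∧ ψ x = ψ x' ∧ ψ y = ψ y' := by
      induction e₁ with | _ x' y' =>
      rw [Sym2.map_mk, Sym2.map_mk] at hmap
      rcases Sym2.eq_iff.1 hmap with ⟨h1, h2⟩ | ⟨h1, h2⟩
      · exact ⟨x', y', rfl, h1, h2⟩
      · exact ⟨y', x', Sym2.eq_swap, h1, h2⟩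
    have hxy : ψ x ≠ ψ y := F.proj_adj_ne he₀
    by_cases h1 : x = x'
    · subst h1
      exact ⟨x, y, y', rfl, rfl, hy, fun h => hne (by rw [h])⟩
    · by_cases h2 : y = y'
      · subst h2
        exact ⟨y, x, x', Sym2.eq_swap, Sym2.eq_swap, hx, h1⟩
      · exfalso
        rcases huniq x x' h1 hx with ⟨rfl, rfl⟩ | ⟨rfl, rfl⟩ <;>
          rcases huniq y y' h2 hy with ⟨h3, -⟩ | ⟨h3, -⟩ <;> subst h3
        · exact hxy rfl
        · exact hxy hψ
        · exact hxy hψ.symm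
        · exact hxy rfl
  obtain ⟨c, a', b', rfl, rfl, hψ', hab'⟩ := hform
  -- Away from the contracted vertex, `c` lies in a single copy, so two edges at `c` of equal kind
  -- are both recoloured or both not.
  have hc : ψ c = u := by
    by_contra hcu
    apply hs₁
    rw [hk₁, hs, F.var_eq c a' he₀ hcu, F.var_eq c b' he₁ hcu]
  refine ⟨a', b', c, hab', he₀, he₁, hc, hψ', hs, hk₁, hs₁, fun p q hpq h => ?_⟩
  rcases huniq a' b' hab' hψ' with ⟨rfl, rfl⟩ | ⟨rfl, rfl⟩
  · exact huniq p q hpq h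
  · exact (huniq p q hpq h).symm

/-- The lifts of `uw` and `vw` both start at the centre and end over `w`, at different vertices
because their kinds differ. So these are the two folded vertices, yet one of the two edges at the
centre is recoloured and lifts are not. -/
theorem false_of_triangle (F : IsFold H u v ψ vr kind var) (huv : H.Adj u v)
    (hconn : H.Connected) (hcard : 3 ≤ Nat.card V) {w : V} (huw : H.Adj u w) (hvw : H.Adj v w) :
    False := by
  obtain ⟨a, b, c, hab, hca, hcb, hc, hψ, hs, hk, -, huniq⟩ := F.exists_centre huv hconn hcard
  have hcu : ∀ x, ψ x = u → x = c := by
    intro x hx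
    by_contra hne
    rcases huniq x c hne (hx.trans hc.symm) with ⟨-, rfl⟩ | ⟨-, rfl⟩
    · exact hcb.ne rfl
    · exact hca.ne rfl
  have hne1 : s(u, w) ≠ s(u, v) := by simp [hvw.ne', huv.ne]
  have hne2 : s(v, w) ≠ s(u, v) := by simp [huw.ne', huv.ne']
  obtain ⟨x, y, hxy, hx, hy, hk1, hs1⟩ := F.exists_lift huv huw hne1
  obtain ⟨x', y', hxy', hx', hy', hk2, hs2⟩ := F.exists_lift huv hvw hne2
  rw [update_of_ne huv.ne] at hx
  rw [update_self] at hx'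
  obtain rfl := hcu x hx
  obtain rfl := hcu x' hx'
  have hyy : y ≠ y' := by
    rintro rfl
    rw [hk1] at hk2
    rcases Sym2.eq_iff.1 hk2 with ⟨h, -⟩ | ⟨h, -⟩
    · exact huv.ne h
    · exact huw.ne h
  rcases huniq y y' hyy (hy.trans hy'.symm) with ⟨rfl, rfl⟩ | ⟨rfl, rfl⟩
  · exact hs1 hs
  · exact hs2 hs

/-- The degree of the centre is so large that, by maximality of `uv`, both folded edges `ca`, `cb`
lie in triangles. But triangle edges lift to triangle edges, so `kind` is injective on them, whereas
`ca` and `cb` have the same kind. -/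
theorem false_of_not_triangle [DecidableRel H.Adj] (F : IsFold H u v ψ vr kind var)
    (huv : H.Adj u v) (hconn : H.Connected) (hcard : 3 ≤ Nat.card V)
    (hu : 2 ≤ H.degree u) (hv : 2 ≤ H.degree v) (hnt : ∀ z, ¬ (H.Adj u z ∧ H.Adj v z))
    (hmax : ∀ x y, H.Adj x y → 2 ≤ H.degree x → 2 ≤ H.degree y →
      (∀ z, ¬ (H.Adj x z ∧ H.Adj y z)) → H.degree x + H.degree y ≤ H.degree u + H.degree v) :
    False := by
  obtain ⟨a, b, c, hab, hca, hcb, hc, hψ, hs, hk, hs', huniq⟩ := F.exists_centre huv hconn hcard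
  have huniq' : ∀ x y, ψ x ≠ ψ a → ψ x = ψ y → x = y := by
    intro x y hx hxy
    by_contra hne
    rcases huniq x y hne hxy with ⟨rfl, -⟩ | ⟨rfl, -⟩
    · exact hx rfl
    · exact hx hψ.symm
  have hau : ψ a ≠ u := hc ▸ (F.proj_adj_ne hca).symm
  have hcu : ∀ x, ψ x = u → x = c := fun x hx =>
    huniq' x c (hx ▸ hau.symm) (hx.trans hc.symm)
  -- the centre has large degree
  have hdeg : H.degree u + H.degree v ≤ H.degree c + 1 := by
    -- Edges at `u` or `v` lift to edges at `c` other than the recoloured `ca`; their ends are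
    -- distinct because `uv` is in no triangle.
    have hsub : (H.neighborFinset u).erase v ∪ (H.neighborFinset v).erase u ⊆
        ((H.neighborFinset c).erase a).image ψ := by
      intro w hw
      simp only [Finset.mem_union, Finset.mem_erase, SimpleGraph.mem_neighborFinset] at hw
      rw [Finset.mem_image]
      simp only [Finset.mem_erase, SimpleGraph.mem_neighborFinset]
      rcases hw with ⟨hw, huw⟩ | ⟨hw, hvw⟩
      · obtain ⟨x, y, hxy, hx, hy, hk1, hs1⟩ := F.exists_lift huv huw (by simp [hw, huv.ne])
        rw [update_of_ne huv.ne] at hx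
        rw [update_of_ne hw] at hy
        obtain rfl := hcu x hx
        refine ⟨y, ⟨?_, hxy⟩, hy⟩
        rintro rfl
        exact hs1 hs
      · obtain ⟨x, y, hxy, hx, hy, hk1, hs1⟩ := F.exists_lift huv hvw (by simp [hw, huv.ne'])
        rw [update_self] at hx
        rw [update_of_ne hvw.ne'] at hy
        obtain rfl := hcu x hx
        refine ⟨y, ⟨?_, hxy⟩, hy⟩
        rintro rfl
        exact hs1 hs
    have hdisj : Disjoint ((H.neighborFinset u).erase v) ((H.neighborFinset v).erase u) := by
      rw [Finset.disjoint_left]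
      intro w hw hw'
      simp only [Finset.mem_erase, SimpleGraph.mem_neighborFinset] at hw hw'
      exact hnt w ⟨hw.2, hw'.2⟩
    have h1 := (Finset.card_le_card hsub).trans Finset.card_image_le
    rw [Finset.card_union_of_disjoint hdisj,
      Finset.card_erase_of_mem ((SimpleGraph.mem_neighborFinset _ _ _).2 huv),
      Finset.card_erase_of_mem ((SimpleGraph.mem_neighborFinset _ _ _).2 huv.symm),
      Finset.card_erase_of_mem ((SimpleGraph.mem_neighborFinset _ _ _).2 hca)] at h1
    simp only [SimpleGraph.card_neighborFinset_eq_degree] at h1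
    omega
  -- the two folded vertices are not leaves
  have hleaf : ∀ x, ψ x = ψ a → H.degree x ≠ 1 := by
    let Λ := Finset.univ.filter fun x => H.degree x = 1
    -- All edges at `x` have the only kind available at the leaf `ψ x` and lie in one copy, so they
    -- coincide.
    have hpull : ∀ x, ψ x ∈ Λ → x ∈ Λ := by
      intro x hx
      simp only [Λ, Finset.mem_filter, Finset.mem_univ, true_and] at hx ⊢
      have hxu : ψ x ≠ u := by
        intro h
        rw [h] at hx
        omega
      have hxv : ψ x ≠ v := F.proj_ne x
      rw [← SimpleGraph.card_neighborFinset_eq_degree] at hx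
      obtain ⟨p, hp⟩ := Finset.card_eq_one.1 hx
      have hkind : ∀ y, H.Adj x y → kind s(x, y) = s(ψ x, p) := by
        intro y hxy
        have h1 := F.map_kind s(x, y) hxy
        have h2 := F.kind_mem s(x, y) hxy
        generalize kind s(x, y) = k at h1 h2
        have hmem : ψ x ∈ k := by
          have h3 : ψ x ∈ Sym2.map (update id v u) k := by
            rw [h1]
            simp
          obtain ⟨d, hd, hd'⟩ := Sym2.mem_map.1 h3
          by_cases hdv : d = v
          · subst hdv
            rw [update_self] at hd'
            exact absurd hd'.symm hxu
          · rw [update_of_ne hdv] at hd'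
            rwa [← hd']
        obtain ⟨d, rfl⟩ := hmem
        have h4 : d ∈ H.neighborFinset (ψ x) := (SimpleGraph.mem_neighborFinset _ _ _).2 h2
        rw [hp, Finset.mem_singleton] at h4
        rw [h4]
      have hle : H.degree x ≤ 1 := by
        rw [← SimpleGraph.card_neighborFinset_eq_degree, Finset.card_le_one]
        intro y hy y' hy'
        rw [SimpleGraph.mem_neighborFinset] at hy hy'
        have hkk : kind s(x, y) = kind s(x, y') := (hkind y hy).trans (hkind y' hy').symm
        have hvv : var s(x, y) = var s(x, y') := by
          rw [F.var_eq x y hy hxu, F.var_eq x y' hy' hxu]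
        have : s(x, y) = s(x, y') := by
          by_cases hsp : kind s(x, y) = var s(x, y)
          · exact F.special_unique hy hy' hsp (by rw [← hkk, hsp, hvv])
          · exact F.kind_inj hy hy' hsp (by rw [← hkk, ← hvv]; exact hsp) hkk
        exact Sym2.congr_right.1 this
      have hpos : 0 < H.degree x := by
        rw [SimpleGraph.degree_pos_iff_exists_adj]
        obtain ⟨y, -, -, hy⟩ := exists_adj_of_connected hconn hcard x x
        exact ⟨y, or_self_iff.1 hy⟩
      omega
    have hsub : Λ ⊆ Λ.image ψ := by
      intro w hw
      have hwv : w ≠ v := by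
        rintro rfl
        simp only [Λ, Finset.mem_filter, Finset.mem_univ, true_and] at hw
        omega
      obtain ⟨z, rfl⟩ := F.proj_surj huv hconn hcard hwv
      exact Finset.mem_image_of_mem _ (hpull z hw)
    have heq : Λ = Λ.image ψ := Finset.eq_of_subset_of_card_le hsub Finset.card_image_le
    have hinj : Set.InjOn ψ Λ := Finset.card_image_iff.1 (congrArg Finset.card heq.symm)
    intro x hx hd
    have hxΛ : x ∈ Λ := Finset.mem_filter.2 ⟨Finset.mem_univ _, hd⟩
    have hmem : ψ a ∈ Λ := by
      rw [heq, ← hx]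
      exact Finset.mem_image_of_mem _ hxΛ
    exact hab (hinj (hpull a hmem) (hpull b (hψ ▸ hmem)) hψ)
  -- hence the two folded edges lie in triangles
  have htri : ∀ x, H.Adj c x → ψ x = ψ a → ∃ z, H.Adj c z ∧ H.Adj x z := by
    intro x hcx hx
    by_contra! hcon
    have h1 := hleaf x hx
    have hpos : 0 < H.degree x :=
      (SimpleGraph.degree_pos_iff_exists_adj _ _).2 ⟨c, hcx.symm⟩
    -- Here `deg c + deg x ≥ (deg u + deg v - 1) + 2`, which exceeds the maximum.
    have := hmax c x hcx (by omega) (by omega) fun z hz => hcon z hz.1 hz.2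
    omega
  -- triangles lift
  have hlift : ∀ x y z, H.Adj x y → H.Adj x z → H.Adj y z → x ≠ ψ a → y ≠ ψ a →
      ∃ X Y Z, H.Adj X Y ∧ H.Adj X Z ∧ H.Adj Y Z ∧ kind s(X, Y) = s(x, y) ∧
        kind s(X, Z) = s(x, z) ∧ kind s(Y, Z) = s(y, z) := by
    intro x y z hxy hxz hyz hxa hya
    have hnuv : ∀ p q r, H.Adj p r → H.Adj q r → s(p, q) ≠ s(u, v) := by
      intro p q r h1 h2 h
      rcases Sym2.eq_iff.1 h with ⟨rfl, rfl⟩ | ⟨rfl, rfl⟩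
      · exact hnt r ⟨h1, h2⟩
      · exact hnt r ⟨h2, h1⟩
    have hσ : ∀ p, p ≠ ψ a → update id v u p ≠ ψ a := by
      intro p hp
      by_cases hpv : p = v
      · subst hpv
        rw [update_self]
        exact hau.symm
      · rwa [update_of_ne hpv]
    obtain ⟨X, Y, hXY, hX, hY, hk1, -⟩ := F.exists_lift huv hxy (hnuv x y z hxz hyz)
    obtain ⟨X', Z, hXZ, hX', hZ, hk2, -⟩ := F.exists_lift huv hxz (hnuv x z y hxy hyz.symm)
    obtain ⟨Y', Z', hYZ, hY', hZ', hk3, -⟩ :=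
      F.exists_lift huv hyz (hnuv y z x hxy.symm hxz.symm)
    obtain rfl := huniq' X X' (hX ▸ hσ x hxa) (hX.trans hX'.symm)
    obtain rfl := huniq' Y Y' (hY ▸ hσ y hya) (hY.trans hY'.symm)
    by_cases hZZ : Z = Z'
    · subst hZZ
      exact ⟨X, Y, Z, hXY, hXZ, hYZ, hk1, hk2, hk3⟩
    have hZab := huniq Z Z' hZZ (hZ.trans hZ'.symm)
    -- At the centre, the two folded edges can be exchanged without changing the kind.
    have hother : ∀ P Q Q', P = c → ((Q = a ∧ Q' = b) ∨ (Q = b ∧ Q' = a)) →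
        H.Adj P Q' ∧ kind s(P, Q') = kind s(P, Q) := by
      rintro P Q Q' rfl (⟨rfl, rfl⟩ | ⟨rfl, rfl⟩)
      · exact ⟨hcb, hk⟩
      · exact ⟨hca, hk.symm⟩
    by_cases hXc : X = c
    · obtain ⟨h1, h2⟩ := hother X Z Z' hXc hZab
      exact ⟨X, Y, Z', hXY, h1, hYZ, hk1, h2.trans hk2, hk3⟩
    by_cases hYc : Y = c
    · obtain ⟨h1, h2⟩ := hother Y Z' Z hYc (by tauto)
      exact ⟨X, Y, Z, hXY, hXZ, h1, hk1, hk2, h2.trans hk3⟩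
    -- With no vertex at the centre, the path `Z X Y Z'` stays in one copy; so would `a` and `b`,
    -- making `ca` and `cb` both recoloured or both not.
    exfalso
    have hvr : ∀ p q, H.Adj p q → ψ p ≠ u → ψ q ≠ u → vr p = vr q := by
      intro p q hpq hp hq
      rw [← F.var_eq p q hpq hp, ← F.var_eq q p hpq.symm hq, Sym2.eq_swap]
    have hXu : ψ X ≠ u := fun h => hXc (hcu X h)
    have hYu : ψ Y ≠ u := fun h => hYc (hcu Y h)
    have hZu : ψ Z ≠ u := by
      rcases hZab with ⟨rfl, -⟩ | ⟨rfl, -⟩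
      · exact hau
      · exact hψ ▸ hau
    have hZu' : ψ Z' ≠ u := by rw [hZ', ← hZ]; exact hZu
    have h1 : vr Z = vr Z' := by
      rw [← hvr X Z hXZ hXu hZu, hvr X Y hXY hXu hYu, hvr Y Z' hYZ hYu hZu']
    have h2 : vr a = vr b := by
      rcases hZab with ⟨rfl, rfl⟩ | ⟨rfl, rfl⟩
      · exact h1
      · exact h1.symm
    apply hs'
    rw [hk, hs, Sym2.eq_swap, F.var_eq a c hca.symm hau, Sym2.eq_swap (a := c) (b := b),
      F.var_eq b c hcb.symm (hψ ▸ hau), h2]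
  -- The edges in triangles. In a triangle at most one vertex is `ψ a`; below it is placed last, as
  -- `hlift` requires.
  let T := Finset.univ.filter fun e : Sym2 V =>
    ∃ x y z, e = s(x, y) ∧ H.Adj x y ∧ H.Adj x z ∧ H.Adj y z
  have hT : ∀ x y z, H.Adj x y → H.Adj x z → H.Adj y z → s(x, y) ∈ T := fun x y z h1 h2 h3 =>
    Finset.mem_filter.2 ⟨Finset.mem_univ _, x, y, z, rfl, h1, h2, h3⟩
  have hsub : T ⊆ T.image kind := by
    intro e he
    obtain ⟨-, x, y, z, rfl, hxy, hxz, hyz⟩ := Finset.mem_filter.1 he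
    rw [Finset.mem_image]
    by_cases hx : x = ψ a
    · obtain ⟨X, Y, Z, hXY, hXZ, hYZ, -, hk2, -⟩ := hlift y z x hyz hxy.symm hxz.symm
        (fun h => hxy.ne (hx.trans h.symm)) (fun h => hxz.ne (hx.trans h.symm))
      exact ⟨_, hT X Z Y hXZ hXY hYZ.symm, hk2.trans Sym2.eq_swap⟩
    · by_cases hy : y = ψ a
      · obtain ⟨X, Y, Z, hXY, hXZ, hYZ, -, hk2, -⟩ := hlift x z y hxz hxy hyz.symm hx
          (fun h => hyz.ne (hy.trans h.symm))
        exact ⟨_, hT X Z Y hXZ hXY hYZ.symm, hk2⟩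
      · obtain ⟨X, Y, Z, hXY, hXZ, hYZ, hk1, -, -⟩ := hlift x y z hxy hxz hyz hx hy
        exact ⟨_, hT X Y Z hXY hXZ hYZ, hk1⟩
  have hinj : Set.InjOn kind T := Finset.card_image_iff.1
    (le_antisymm Finset.card_image_le (Finset.card_le_card hsub))
  obtain ⟨z, hz1, hz2⟩ := htri a hca rfl
  obtain ⟨z', hz1', hz2'⟩ := htri b hcb hψ.symm
  have := hinj (hT c a z hca hz1 hz2) (hT c b z' hcb hz1' hz2') hk.symm
  exact hab (Sym2.congr_right.1 this)

end IsFold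

end Fold

/-! ### The blow-up construction and its upper bounds -/

section BlowUp

variable {V W K : Type*}

theorem exists_sym2_extension [Nonempty K] (G : SimpleGraph W) (c : W → W → K)
    (hc : ∀ p q, G.Adj p q → c p q = c q p) :
    ∃ χ : Sym2 W → K, ∀ p q, G.Adj p q → χ s(p, q) = c p q := by
  classical
  refine ⟨fun e => c (Quot.out e).1 (Quot.out e).2, fun p q hpq => ?_⟩
  have h : s((Quot.out s(p, q)).1, (Quot.out s(p, q)).2) = s(p, q) := Quot.out_eq _
  simp only
  rcases Sym2.eq_iff.1 h with ⟨h1, h2⟩ | ⟨h1, h2⟩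
  · rw [h1, h2]
  · rw [h1, h2, hc p q hpq]

variable {X B : Type*}

/-- Copies of `H` minus the vertices `u` and `v`, indexed by `B × Sym2 V`, together with a set `X`
of vertices; in the copies with first index `b`, the vertex `x` of `X` is joined to `w` if `w` is
adjacent in `H` to `root b x w`, which is `u` or `v`. -/
def blowUp (H : SimpleGraph V) (u v : V) (root : B → X → V → V) :
    SimpleGraph (X ⊕ (B × Sym2 V × V)) where
  Adj
    | .inl _, .inl _ => False
    | .inl x, .inr (b, _, w) => H.Adj (root b x w) w ∧ w ≠ u ∧ w ≠ v
    | .inr (b, _, w), .inl x => H.Adj (root b x w) w ∧ w ≠ u ∧ w ≠ v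
    | .inr (b, i, w), .inr (b', i', w') =>
        b = b' ∧ i = i' ∧ H.Adj w w' ∧ (w ≠ u ∧ w ≠ v) ∧ w' ≠ u ∧ w' ≠ v
  symm := ⟨by
    rintro (x | ⟨b, i, w⟩) (y | ⟨b', i', w'⟩) h
    · exact h
    · exact h
    · exact h
    · exact ⟨h.1.symm, h.2.1.symm, h.2.2.1.symm, h.2.2.2.2, h.2.2.2.1⟩⟩
  loopless := ⟨by
    rintro (x | ⟨b, i, w⟩) h
    · exact h
    · exact h.2.2.1.ne rfl⟩

/-- The edge of `H` over which an edge of `blowUp` lies. -/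
def blowUpKind (u v : V) (root : B → X → V → V) :
    X ⊕ (B × Sym2 V × V) → X ⊕ (B × Sym2 V × V) → Sym2 V
  | .inl _, .inl _ => s(u, v)
  | .inl x, .inr (b, _, w) => s(root b x w, w)
  | .inr (b, _, w), .inl x => s(root b x w, w)
  | .inr (_, _, w), .inr (_, _, w') => s(w, w')

/-- The second index of the copy in which an edge of `blowUp` lies. -/
def blowUpVar (u v : V) : X ⊕ (B × Sym2 V × V) → X ⊕ (B × Sym2 V × V) → Sym2 V
  | .inl _, .inl _ => s(u, v)
  | .inl _, .inr (_, i, _) => i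
  | .inr (_, i, _), _ => i

variable {H : SimpleGraph V} {u v : V} {root : B → X → V → V}

theorem blowUpKind_symm (p q : X ⊕ (B × Sym2 V × V)) :
    blowUpKind u v root p q = blowUpKind u v root q p := by
  rcases p with x | ⟨b, i, w⟩ <;> rcases q with y | ⟨b', i', w'⟩ <;> try rfl
  exact Sym2.eq_swap

theorem blowUpVar_symm {p q : X ⊕ (B × Sym2 V × V)} (h : (blowUp H u v root).Adj p q) :
    blowUpVar u v p q = blowUpVar u v q p := by
  rcases p with x | ⟨b, i, w⟩ <;> rcases q with y | ⟨b', i', w'⟩ <;> try rfl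
  exact h.2.1

theorem exists_extremal_edge [Fintype V] [DecidableRel H.Adj]
    (h : ∃ x y, H.Adj x y ∧ 2 ≤ H.degree x ∧ 2 ≤ H.degree y ∧
      ∀ z, ¬ (H.Adj x z ∧ H.Adj y z)) :
    ∃ u v, H.Adj u v ∧ 2 ≤ H.degree u ∧ 2 ≤ H.degree v ∧ (∀ z, ¬ (H.Adj u z ∧ H.Adj v z)) ∧
      ∀ x y, H.Adj x y → 2 ≤ H.degree x → 2 ≤ H.degree y →
        (∀ z, ¬ (H.Adj x z ∧ H.Adj y z)) → H.degree x + H.degree y ≤ H.degree u + H.degree v := by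
  classical
  let S : Finset (V × V) := Finset.univ.filter fun p => H.Adj p.1 p.2 ∧ 2 ≤ H.degree p.1 ∧
    2 ≤ H.degree p.2 ∧ ∀ z, ¬ (H.Adj p.1 z ∧ H.Adj p.2 z)
  obtain ⟨x, y, hxy⟩ := h
  obtain ⟨p, hp, hmax⟩ := S.exists_max_image (fun p => H.degree p.1 + H.degree p.2)
    ⟨(x, y), Finset.mem_filter.2 ⟨Finset.mem_univ _, hxy⟩⟩
  obtain ⟨-, h1, h2, h3, h4⟩ := Finset.mem_filter.1 hp
  exact ⟨p.1, p.2, h1, h2, h3, h4, fun x y h1 h2 h3 h4 =>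
    hmax (x, y) (Finset.mem_filter.2 ⟨Finset.mem_univ _, h1, h2, h3, h4⟩)⟩

variable [DecidableEq V]

/-- The colour of an edge of `blowUp`: that of the edge of `H` below it, except that the edge
indexing the copy gets the colour of `uv`. -/
def blowUpColour (u v : V) (root : B → X → V → V) (κ : Sym2 V → K)
    (p q : X ⊕ (B × Sym2 V × V)) : K :=
  κ (if blowUpKind u v root p q = blowUpVar u v p q then s(u, v) else blowUpKind u v root p q)

theorem exists_blowUp_colouring [Nonempty K] (κ : Sym2 V → K) :
    ∃ χ : Sym2 (X ⊕ (B × Sym2 V × V)) → K, ∀ p q, (blowUp H u v root).Adj p q →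
      χ s(p, q) = blowUpColour u v root κ p q := by
  refine exists_sym2_extension _ _ fun p q h => ?_
  rw [blowUpColour, blowUpColour, blowUpKind_symm, blowUpVar_symm h]

/-- A rainbow copy, recorded by the projections, kinds and indices of its vertices and edges, is a
fold; distinct colours give the injectivity that a fold requires. -/
theorem not_rainbowIn_blowUp (hroot : ∀ b x w, root b x w = u ∨ root b x w = v)
    (huv : H.Adj u v) (hconn : H.Connected)
    (hF : ∀ ψ vr kind var, ¬ IsFold H u v ψ vr kind var) (κ : Sym2 V → K)
    (χ : Sym2 (X ⊕ (B × Sym2 V × V)) → K)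
    (hχ : ∀ p q, (blowUp H u v root).Adj p q → χ s(p, q) = blowUpColour u v root κ p q) :
    ¬ RainbowIn H (blowUp H u v root) χ := by
  rintro ⟨f, -, hadj, hinj⟩
  have hne : Nonempty (Sym2 V) := ⟨s(u, v)⟩
  obtain ⟨kind, hkind⟩ := exists_sym2_extension H
    (fun a b => blowUpKind u v root (f a) (f b)) (fun a b _ => blowUpKind_symm _ _)
  obtain ⟨var, hvar⟩ := exists_sym2_extension H
    (fun a b => blowUpVar u v (f a) (f b)) (fun a b h => blowUpVar_symm (hadj a b h))
  let ψ : V → V := fun a => Sum.elim (fun _ => u) (fun z => z.2.2) (f a)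
  let vr : V → Sym2 V := fun a => Sum.elim (fun _ => s(u, v)) (fun z => z.2.1) (f a)
  have hcol : ∀ e ∈ H.edgeSet, χ (e.map f) = κ (if kind e = var e then s(u, v) else kind e) := by
    intro e he
    induction e with | _ a b =>
    rw [Sym2.map_mk, hχ _ _ (hadj a b he), blowUpColour, hkind a b he, hvar a b he]
  have hnv : ∀ a, ψ a ≠ v := by
    intro a
    have : Nontrivial V := ⟨u, v, huv.ne⟩
    obtain ⟨b, hab⟩ := hconn.preconnected.exists_adj_of_nontrivial a
    have h := hadj a b hab
    simp only [ψ]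
    rcases hfa : f a with x | ⟨b₁, i, w⟩
    · exact huv.ne
    · rw [hfa] at h
      rcases hfb : f b with y | ⟨b₂, i', w'⟩ <;> rw [hfb] at h
      · exact h.2.2
      · exact h.2.2.2.1.2
  refine hF ψ vr kind var ⟨hnv, ?_, ?_, ?_, ?_, ?_⟩
  · intro e he
    induction e with | _ a b =>
    have h := hadj a b he
    rw [hkind a b he]
    rcases hfa : f a with x | ⟨b₁, i, w⟩ <;> rcases hfb : f b with y | ⟨b₂, i', w'⟩ <;>
      rw [hfa, hfb] at h
    · exact h.elim
    · exact h.1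
    · exact h.1
    · exact h.2.2.1
  · intro e he
    induction e with | _ a b =>
    have h := hadj a b he
    rw [hkind a b he]
    rcases hfa : f a with x | ⟨b₁, i, w⟩ <;> rcases hfb : f b with y | ⟨b₂, i', w'⟩ <;>
      rw [hfa, hfb] at h
    · exact h.elim
    · simp [blowUpKind, h.2.1, h.2.2]
    · simp [blowUpKind, h.2.1, h.2.2]
    · simp [blowUpKind, h.2.2.2.1.1, h.2.2.2.1.2]
  · intro e he
    induction e with | _ a b =>
    have h := hadj a b he
    rw [hkind a b he]
    simp only [Sym2.map_mk, ψ]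
    have hr : ∀ b x w, update id v u (root b x w) = u := by
      intro b x w
      rcases hroot b x w with h | h <;> rw [h]
      · rw [update_of_ne huv.ne]
        rfl
      · rw [update_self]
    rcases hfa : f a with x | ⟨b₁, i, w⟩ <;> rcases hfb : f b with y | ⟨b₂, i', w'⟩ <;>
      rw [hfa, hfb] at h
    · exact h.elim
    · simp [blowUpKind, hr, update_of_ne h.2.2]
    · simp only [blowUpKind, Sym2.map_mk, hr, update_of_ne h.2.2]
      exact Sym2.eq_swap
    · simp [blowUpKind, update_of_ne h.2.2.2.1.2, update_of_ne h.2.2.2.2.2]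
  · intro a b hab hψ
    rw [hvar a b hab]
    simp only [vr, ψ] at hψ ⊢
    rcases hfa : f a with x | ⟨b₁, i, w⟩
    · rw [hfa] at hψ
      exact absurd rfl hψ
    · rfl
  · refine fun e he e' he' h => hinj he he' ?_
    simp only at h ⊢
    rw [hcol e he, hcol e' he', h]

/-- The new edge plays `uv` with colour `j`. Use the copy in which the edge of `H` coloured `j` has
been given the colour of `uv`: the two colours are swapped and the copy stays rainbow. -/
theorem rainbowIn_of_blowUp_le (huv : H.Adj u v) {κ : Sym2 V → K} (hκ : Set.InjOn κ H.edgeSet)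
    {χ : Sym2 (X ⊕ (B × Sym2 V × V)) → K}
    (hχ : ∀ p q, (blowUp H u v root).Adj p q → χ s(p, q) = blowUpColour u v root κ p q)
    {x y : X} (hxy : x ≠ y) (b : B) (hx : ∀ w, w ≠ v → H.Adj u w → root b x w = u)
    (hy : ∀ w, w ≠ u → H.Adj v w → root b y w = v) {G : SimpleGraph (X ⊕ (B × Sym2 V × V))}
    (hG : blowUp H u v root ≤ G) (hadj : G.Adj (.inl x) (.inl y)) : RainbowIn H G χ := by
  set j := χ s(.inl x, .inl y) with hj
  -- If `j` is not the colour of an edge other than `uv`, take `i = uv`: this is never a kind, so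
  -- nothing is recoloured in that copy.
  obtain ⟨i, hi1, hi2⟩ : ∃ i : Sym2 V, (i ∈ H.edgeSet → i ≠ s(u, v) → κ i = j) ∧
      ∀ e ∈ H.edgeSet, e ≠ s(u, v) → κ e = j → e = i := by
    by_cases h : ∃ e ∈ H.edgeSet, e ≠ s(u, v) ∧ κ e = j
    · obtain ⟨e, he, -, hej⟩ := h
      exact ⟨e, fun _ _ => hej, fun e' he' _ h' => hκ he' he (h'.trans hej.symm)⟩
    · push Not at h
      exact ⟨s(u, v), fun _ h' => absurd rfl h', fun e he hne h' => absurd h' (h e he hne)⟩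
  let g : V → X ⊕ (B × Sym2 V × V) := fun w =>
    if w = u then .inl x else if w = v then .inl y else .inr (b, i, w)
  have gu : g u = .inl x := if_pos rfl
  have gv : g v = .inl y := by simp [g, huv.ne']
  have gw : ∀ w, w ≠ u → w ≠ v → g w = .inr (b, i, w) := fun w h1 h2 => by simp [g, h1, h2]
  have key : ∀ c d, H.Adj c d → s(c, d) ≠ s(u, v) → (blowUp H u v root).Adj (g c) (g d) ∧
      blowUpKind u v root (g c) (g d) = s(c, d) ∧ blowUpVar u v (g c) (g d) = i := by
    intro c d hcd hne
    by_cases hcu : c = u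
    · subst hcu
      have hdv : d ≠ v := fun h => hne (by rw [h])
      rw [gu, gw d hcd.ne' hdv]
      refine ⟨⟨?_, hcd.ne', hdv⟩, ?_, rfl⟩
      · rwa [hx d hdv hcd]
      · change s(root b x d, d) = _
        rw [hx d hdv hcd]
    by_cases hcv : c = v
    · subst hcv
      have hdu : d ≠ u := fun h => hne (by rw [h]; exact Sym2.eq_swap)
      rw [gv, gw d hdu hcd.ne']
      refine ⟨⟨?_, hdu, hcd.ne'⟩, ?_, rfl⟩
      · rwa [hy d hdu hcd]
      · change s(root b y d, d) = _
        rw [hy d hdu hcd]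
    by_cases hdu : d = u
    · subst hdu
      rw [gu, gw c hcu hcv]
      refine ⟨⟨?_, hcu, hcv⟩, ?_, rfl⟩
      · rw [hx c hcv hcd.symm]
        exact hcd.symm
      · change s(root b x c, c) = _
        rw [hx c hcv hcd.symm]
        exact Sym2.eq_swap
    by_cases hdv : d = v
    · subst hdv
      rw [gv, gw c hcu hcv]
      refine ⟨⟨?_, hcu, hcv⟩, ?_, rfl⟩
      · rw [hy c hcu hcd.symm]
        exact hcd.symm
      · change s(root b y c, c) = _
        rw [hy c hcu hcd.symm]
        exact Sym2.eq_swap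
    rw [gw c hcu hcv, gw d hdu hdv]
    exact ⟨⟨rfl, rfl, hcd, ⟨hcu, hcv⟩, hdu, hdv⟩, rfl, rfl⟩
  have huvj : χ ((s(u, v)).map g) = j := by rw [Sym2.map_mk, gu, gv]
  have hcol : ∀ e ∈ H.edgeSet, e ≠ s(u, v) →
      χ (e.map g) = κ (if e = i then s(u, v) else e) := by
    intro e he hne
    induction e with | _ c d =>
    obtain ⟨h1, h2, h3⟩ := key c d he hne
    rw [Sym2.map_mk, hχ _ _ h1, blowUpColour, h2, h3]
  have hmem : ∀ e ∈ H.edgeSet, (if e = i then s(u, v) else e) ∈ H.edgeSet := by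
    intro e he
    split_ifs
    · exact huv
    · exact he
  have hnj : ∀ e ∈ H.edgeSet, e ≠ s(u, v) → χ (e.map g) ≠ j := by
    intro e he hne h
    rw [hcol e he hne] at h
    split_ifs at h with hei
    · subst hei
      exact hne (hκ he huv ((hi1 he hne).trans h.symm))
    · exact hei (hi2 e he hne h)
  refine ⟨g, ?_, ?_, ?_⟩
  · classical
    refine LeftInverse.injective
      (g := Sum.elim (fun z => if z = x then u else v) fun z => z.2.2) fun c => ?_
    by_cases hcu : c = u
    · rw [hcu, gu]
      exact if_pos rfl
    · by_cases hcv : c = v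
      · rw [hcv, gv]
        exact if_neg hxy.symm
      · rw [gw c hcu hcv]
        rfl
  · intro c d hcd
    by_cases hne : s(c, d) = s(u, v)
    · rcases Sym2.eq_iff.1 hne with ⟨rfl, rfl⟩ | ⟨rfl, rfl⟩
      · rw [gu, gv]
        exact hadj
      · rw [gu, gv]
        exact hadj.symm
    · exact hG (key c d hcd hne).1
  · intro e he e' he' h
    simp only at h
    by_cases h1 : e = s(u, v) <;> by_cases h2 : e' = s(u, v)
    · rw [h1, h2]
    · rw [h1, huvj] at h
      exact absurd h.symm (hnj e' he' h2)
    · rw [h2, huvj] at h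
      exact absurd h (hnj e he h1)
    · rw [hcol e he h1, hcol e' he' h2] at h
      have h3 := hκ (hmem e he) (hmem e' he') h
      split_ifs at h3 with h4 h5 h5
      · rw [h4, h5]
      · exact absurd h3.symm h2
      · exact absurd h3 h1
      · exact h3

/-- No pair inside `X` can be added, so every edge of a saturated extension meets the copies. -/
theorem rainbowSat_blowUp_le [Fintype V] [Fintype X] [Fintype B] {t : ℕ}
    (ht : H.edgeSet.ncard ≤ t) (hroot : ∀ b x w, root b x w = u ∨ root b x w = v)
    (huv : H.Adj u v) (hconn : H.Connected)
    (hF : ∀ ψ vr kind var, ¬ IsFold H u v ψ vr kind var)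
    (hsep : ∀ x y, x ≠ y → ∃ b,
      ((∀ w, w ≠ v → H.Adj u w → root b x w = u) ∧
        ∀ w, w ≠ u → H.Adj v w → root b y w = v) ∨
      ((∀ w, w ≠ v → H.Adj u w → root b y w = u) ∧
        ∀ w, w ≠ u → H.Adj v w → root b x w = v)) :
    rainbowSat H t (Fintype.card X + Fintype.card B * Fintype.card (Sym2 V × V)) ≤
      Fintype.card B * Fintype.card (Sym2 V × V) *
        (Fintype.card X + Fintype.card B * Fintype.card (Sym2 V × V)) := by
  classical
  have hcard : Fintype.card (X ⊕ (B × Sym2 V × V)) =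
      Fintype.card X + Fintype.card B * Fintype.card (Sym2 V × V) := by
    rw [Fintype.card_sum, Fintype.card_prod B]
  obtain ⟨κ, hκ⟩ : ∃ κ : Sym2 V → Fin t, Set.InjOn κ H.edgeSet := by
    have h1 : Fintype.card H.edgeSet ≤ Fintype.card (Fin t) := by
      rwa [Fintype.card_fin, ← Nat.card_eq_fintype_card]
    obtain ⟨κ⟩ := Function.Embedding.nonempty_of_card_le h1
    have hne : Nonempty (Fin t) := ⟨κ ⟨s(u, v), huv⟩⟩
    refine ⟨fun e => if h : e ∈ H.edgeSet then κ ⟨e, h⟩ else Classical.arbitrary _, ?_⟩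
    intro e he e' he' h
    simp only [dif_pos he, dif_pos he'] at h
    exact congrArg Subtype.val (κ.injective h)
  have hne : Nonempty (Fin t) := ⟨κ s(u, v)⟩
  obtain ⟨χ, hχ⟩ := exists_blowUp_colouring (H := H) (u := u) (v := v) (root := root) κ
  have hfree := not_rainbowIn_blowUp hroot huv hconn hF κ χ hχ
  rw [← hcard]
  refine rainbowSat_le_mul hfree _ (fun _ => Finset.univ.image Sum.inr) (fun _ => ?_) ?_
  · refine Finset.card_image_le.trans_eq ?_
    rw [Finset.card_univ, Fintype.card_prod B]
  · rintro (x | p) (y | q) hxy h1 h2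
    · refine ⟨id, fun χ' hχ' => ?_⟩
      have hxy' : x ≠ y := fun h => hxy (by rw [h])
      have hχ'' : ∀ p q, (blowUp H u v root).Adj p q →
          χ' s(p, q) = blowUpColour u v root κ p q := fun p q h => by
        rw [hχ' _ h, hχ p q h]
      have hadj : (blowUp H u v root ⊔ SimpleGraph.edge (Sum.inl x) (Sum.inl y)).Adj
          (.inl x) (.inl y) :=
        Or.inr ((SimpleGraph.edge_adj ..).2 ⟨Or.inl ⟨rfl, rfl⟩, hxy⟩)
      obtain ⟨b, ⟨hb1, hb2⟩ | ⟨hb1, hb2⟩⟩ := hsep x y hxy'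
      · exact rainbowIn_of_blowUp_le huv hκ hχ'' hxy' b hb1 hb2 le_sup_left hadj
      · exact rainbowIn_of_blowUp_le huv hκ hχ'' hxy'.symm b hb1 hb2 le_sup_left hadj.symm
    · exact absurd (Finset.mem_image_of_mem _ (Finset.mem_univ q)) h1
    · exact absurd (Finset.mem_image_of_mem _ (Finset.mem_univ p)) h2
    · exact absurd (Finset.mem_image_of_mem _ (Finset.mem_univ q)) h1

/-- The vertices of `X` carry distinct binary words of length `L`, and the digit `b` decides the
role in the copies of index `b`. Distinct words differ in some digit, where the two roles are
opposite. -/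
theorem rainbowSat_le_of_triangle [Fintype V] {t : ℕ} (ht : H.edgeSet.ncard ≤ t)
    (hconn : H.Connected) (hcard : 3 ≤ Nat.card V) {w : V} (huv : H.Adj u v) (huw : H.Adj u w)
    (hvw : H.Adj v w) (n L : ℕ) (hn : n ≤ 2 ^ L) (hL : L * Fintype.card (Sym2 V × V) ≤ n) :
    rainbowSat H t n ≤ L * Fintype.card (Sym2 V × V) * n := by
  have hle : Fintype.card (Fin (n - L * Fintype.card (Sym2 V × V))) ≤
      Fintype.card (Fin L → Bool) := by
    simp only [Fintype.card_fin, Fintype.card_pi, Fintype.card_bool, Finset.prod_const,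
      Finset.card_univ]
    omega
  obtain ⟨β⟩ := Function.Embedding.nonempty_of_card_le hle
  have := rainbowSat_blowUp_le (H := H) (u := u) (v := v) (t := t)
    (X := Fin (n - L * Fintype.card (Sym2 V × V))) (B := Fin L)
    (root := fun b x _ => if β x b then u else v) ht ?_ huv hconn
    (fun ψ vr kind var F => F.false_of_triangle huv hconn hcard huw hvw) ?_
  · rwa [Fintype.card_fin, Fintype.card_fin, Nat.sub_add_cancel hL] at this
  · intro b x _
    split_ifs <;> simp
  · intro x y hxy
    obtain ⟨b, hb⟩ : ∃ b, β x b ≠ β y b := by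
      by_contra! h
      exact hxy (β.injective (funext h))
    refine ⟨b, ?_⟩
    rcases hx : β x b <;> rcases hy : β y b
    · exact absurd (hx.trans hy.symm) hb
    · exact Or.inr ⟨fun _ _ _ => by simp, fun _ _ _ => by simp⟩
    · exact Or.inl ⟨fun _ _ _ => by simp, fun _ _ _ => by simp⟩
    · exact absurd (hx.trans hy.symm) hb

/-- Since `u` and `v` have no common neighbour, every vertex of `X` can be joined to the neighbours
of both and play either role in the same copy. -/
theorem rainbowSat_le_of_not_triangle [Fintype V] [DecidableRel H.Adj] {t : ℕ}
    (ht : H.edgeSet.ncard ≤ t) (hconn : H.Connected) (hcard : 3 ≤ Nat.card V)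
    (h : ∃ x y, H.Adj x y ∧ 2 ≤ H.degree x ∧ 2 ≤ H.degree y ∧ ∀ z, ¬ (H.Adj x z ∧ H.Adj y z))
    (n : ℕ) (hn : Fintype.card (Sym2 V × V) ≤ n) :
    rainbowSat H t n ≤ Fintype.card (Sym2 V × V) * n := by
  obtain ⟨u, v, huv, hu, hv, hnt, hmax⟩ := exists_extremal_edge h
  have := rainbowSat_blowUp_le (H := H) (u := u) (v := v) (t := t)
    (X := Fin (n - Fintype.card (Sym2 V × V))) (B := Unit)
    (root := fun _ _ w => if H.Adj u w then u else v) ht ?_ huv hconn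
    (fun ψ vr kind var F => F.false_of_not_triangle huv hconn hcard hu hv hnt hmax) ?_
  · rwa [Fintype.card_fin, Fintype.card_unit, one_mul, Nat.sub_add_cancel hn] at this
  · intro _ _ w
    split_ifs <;> simp
  · intro x y _
    refine ⟨(), Or.inl ⟨fun w _ hw => if_pos hw, fun w _ hw => if_neg fun h => hnt w ⟨h, hw⟩⟩⟩

end BlowUp

/-! ### Rotated cliques: rainbow linear hypergraphs -/

section RotatedClique

variable {V W P Bl C : Type*}

/-- A partite linear hypergraph (with blocks `Bl`, positions `P` and vertices `W`) without
triangles, each block being a clique whose pairs of positions are coloured by `C` in such a way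
that the blocks are rainbow, the colouring is proper, and each block and each vertex sees all
colours. -/
structure IsRainbowSystem (vtx : Bl → P → W) (col : Bl → P → P → C) : Prop where
  pos : ∀ b p b' p', vtx b p = vtx b' p' → p = p'
  linear : ∀ b b' p q, p ≠ q → vtx b p = vtx b' p → vtx b q = vtx b' q → b = b'
  triangle : ∀ b₁ b₂ b₃ p q s, p ≠ q → q ≠ s → p ≠ s → vtx b₁ p = vtx b₂ p →
    vtx b₂ q = vtx b₃ q → vtx b₃ s = vtx b₁ s → b₁ = b₂
  col_symm : ∀ b p q, col b p q = col b q p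
  rainbow : ∀ b p q p' q', p ≠ q → p' ≠ q' → col b p q = col b p' q' → s(p, q) = s(p', q')
  proper : ∀ b b' p q q', p ≠ q → p ≠ q' → vtx b p = vtx b' p → col b p q = col b' p q' → b = b'
  seen : ∀ b p i, ∃ b' q, p ≠ q ∧ vtx b' p = vtx b p ∧ col b' p q = i
  onto : ∀ b i, ∃ p q, p ≠ q ∧ col b p q = i

/-- The graph in which two vertices are adjacent if they lie in a common block. -/
def systemGraph (vtx : Bl → P → W) (hpos : ∀ b p b' p', vtx b p = vtx b' p' → p = p') :
    SimpleGraph W where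
  Adj x y := ∃ b p q, p ≠ q ∧ x = vtx b p ∧ y = vtx b q
  symm := ⟨by
    rintro x y ⟨b, p, q, hpq, hx, hy⟩
    exact ⟨b, q, p, hpq.symm, hy, hx⟩⟩
  loopless := ⟨by
    rintro x ⟨b, p, q, hpq, hx, hy⟩
    exact hpq (hpos _ _ _ _ (hx.symm.trans hy))⟩

/-- `H` is a clique with the edge `uv` replaced by an edge from `u` to a new vertex `l`. -/
structure IsRotatedClique (H : SimpleGraph V) (u v l : V) : Prop where
  ne_uv : u ≠ v
  ne_ul : u ≠ l
  ne_vl : v ≠ l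
  adj_iff : ∀ x y, H.Adj x y ↔
    (x ≠ y ∧ x ≠ l ∧ y ≠ l ∧ s(x, y) ≠ s(u, v)) ∨ s(x, y) = s(u, l)

theorem IsRotatedClique.adj_ul {H : SimpleGraph V} {u v l : V} (h : IsRotatedClique H u v l) :
    H.Adj u l := (h.adj_iff _ _).2 (Or.inr rfl)

theorem IsRotatedClique.eq_or {H : SimpleGraph V} {u v l : V} (h : IsRotatedClique H u v l)
    {e : Sym2 V} (he : e ∈ H.edgeSet) :
    e = s(u, l) ∨ ∃ x y, e = s(x, y) ∧ x ≠ y ∧ x ≠ l ∧ y ≠ l ∧ s(x, y) ≠ s(u, v) := by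
  induction e with | _ x y =>
  rcases (h.adj_iff _ _).1 he with h | h
  · exact Or.inr ⟨x, y, rfl, h⟩
  · exact Or.inl h

namespace IsRainbowSystem

variable {K : Type*} {vtx : Bl → P → W} {col : Bl → P → P → C}

theorem exists_colouring [Nonempty K] (S : IsRainbowSystem vtx col) (κ : C → K) :
    ∃ χ : Sym2 W → K, ∀ b p q, p ≠ q → χ s(vtx b p, vtx b q) = κ (col b p q) := by
  classical
  refine ⟨fun e => if h : ∃ z : Bl × P × P, z.2.1 ≠ z.2.2 ∧
    e = s(vtx z.1 z.2.1, vtx z.1 z.2.2) then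
      κ (col h.choose.1 h.choose.2.1 h.choose.2.2) else Classical.arbitrary K, ?_⟩
  intro b p q hpq
  have h : ∃ z : Bl × P × P, z.2.1 ≠ z.2.2 ∧
      s(vtx b p, vtx b q) = s(vtx z.1 z.2.1, vtx z.1 z.2.2) := ⟨(b, p, q), hpq, rfl⟩
  simp only [dif_pos h]
  obtain ⟨h1, h2⟩ := h.choose_spec
  generalize h.choose = z at h1 h2
  obtain ⟨b', p', q'⟩ := z
  simp only at h1 h2 ⊢
  rcases Sym2.eq_iff.1 h2 with ⟨h3, h4⟩ | ⟨h3, h4⟩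
  · obtain rfl := S.pos _ _ _ _ h3
    obtain rfl := S.pos _ _ _ _ h4
    rw [S.linear _ _ _ _ hpq h3 h4]
  · obtain rfl := S.pos _ _ _ _ h3
    obtain rfl := S.pos _ _ _ _ h4
    rw [S.linear _ _ _ _ hpq h3 h4, S.col_symm]

/-- Triangles lie in single blocks, so the clique part of `H` fills one block. The pendant edge lies
in another block, and its colour occurs in the first one. -/
theorem not_rainbowIn [Fintype V] [Fintype P] (S : IsRainbowSystem vtx col)
    {H : SimpleGraph V} {u v l : V} (hH : IsRotatedClique H u v l)
    (hP : Fintype.card V = Fintype.card P + 1) (hP' : 4 ≤ Fintype.card P) {κ : C → K}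
    {χ : Sym2 W → K} (hχ : ∀ b p q, p ≠ q → χ s(vtx b p, vtx b q) = κ (col b p q)) :
    ¬ RainbowIn H (systemGraph vtx S.pos) χ := by
  classical
  rintro ⟨f, hf, hadj, hinj⟩
  have htri : ∀ x y z, H.Adj x y → H.Adj y z → H.Adj x z → ∀ b p q, p ≠ q → f x = vtx b p →
      f y = vtx b q → ∃ s, f z = vtx b s := by
    intro x y z hxy hyz hxz b p q hpq hx hy
    obtain ⟨b₂, q', s, hqs, hy', hz⟩ := hadj y z hyz
    obtain ⟨b₃, p', s', hps, hx', hz'⟩ := hadj x z hxz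
    obtain rfl := S.pos _ _ _ _ (hx.symm.trans hx')
    obtain rfl := S.pos _ _ _ _ (hy.symm.trans hy')
    obtain rfl := S.pos _ _ _ _ (hz.symm.trans hz')
    have := S.triangle b b₂ b₃ q s p hqs hps.symm hpq.symm (hy.symm.trans hy')
      (hz.symm.trans hz') (hx'.symm.trans hx)
    exact ⟨s, this ▸ hz⟩
  -- Two clique vertices outside `{u, v}` exist because the order is at least `4`; they form
  -- triangles with every other clique vertex.
  obtain ⟨c, hc⟩ : ∃ c, c ∉ ({u, v, l} : Finset V) := by
    by_contra! h
    have h1 := Finset.card_le_card (fun z _ => h z : (Finset.univ : Finset V) ⊆ {u, v, l})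
    have h2 := Finset.card_le_three (a := u) (b := v) (c := l)
    rw [Finset.card_univ] at h1
    omega
  obtain ⟨d, hd⟩ : ∃ d, d ∉ ({c, u, v, l} : Finset V) := by
    by_contra! h
    have h1 := Finset.card_le_card (fun z _ => h z : (Finset.univ : Finset V) ⊆ {c, u, v, l})
    have h2 := Finset.card_le_four (a := c) (b := u) (c := v) (d := l)
    rw [Finset.card_univ] at h1
    omega
  simp only [Finset.mem_insert, Finset.mem_singleton, not_or] at hc hd
  have hadj' : ∀ x y, x ≠ y → x ≠ l → y ≠ l → y ≠ u → y ≠ v → H.Adj x y := by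
    intro x y h1 h2 h3 h4 h5
    refine (hH.adj_iff _ _).2 (Or.inl ⟨h1, h2, h3, fun h => ?_⟩)
    rcases Sym2.eq_iff.1 h with ⟨-, h⟩ | ⟨-, h⟩
    · exact h5 h
    · exact h4 h
  have hcd : H.Adj c d := hadj' c d (Ne.symm hd.1) hc.2.2 hd.2.2.2 hd.2.1 hd.2.2.1
  obtain ⟨b, p, q, hpq, hfc, hfd⟩ := hadj c d hcd
  have hall : ∀ x, ∃ s, x ≠ l → f x = vtx b s := by
    intro x
    by_cases hxl : x = l
    · exact ⟨p, fun h => absurd hxl h⟩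
    by_cases hxc : x = c
    · exact ⟨p, fun _ => hxc ▸ hfc⟩
    by_cases hxd : x = d
    · exact ⟨q, fun _ => hxd ▸ hfd⟩
    obtain ⟨s, hs⟩ := htri c d x hcd (hadj' x d hxd hxl hd.2.2.2 hd.2.1 hd.2.2.1).symm
      (hadj' x c hxc hxl hc.2.2 hc.1 hc.2.1).symm b p q hpq hfc hfd
    exact ⟨s, fun _ => hs⟩
  choose π hπ using hall
  have hπinj : ∀ x y, x ≠ l → y ≠ l → π x = π y → x = y := by
    intro x y hx hy h
    exact hf (by rw [hπ x hx, hπ y hy, h])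
  have hπsurj : ∀ s, ∃ x, x ≠ l ∧ π x = s := by
    have h1 : ((Finset.univ.erase l).image π).card = Fintype.card P := by
      rw [Finset.card_image_of_injOn, Finset.card_erase_of_mem (Finset.mem_univ _),
        Finset.card_univ, hP, Nat.add_sub_cancel]
      intro x hx y hy h
      exact hπinj x y (by simpa using hx) (by simpa using hy) h
    have h2 := (Finset.card_eq_iff_eq_univ _).1 h1
    intro s
    obtain ⟨x, hx, hxs⟩ := Finset.mem_image.1 (h2 ▸ Finset.mem_univ s)
    exact ⟨x, by simpa using hx, hxs⟩
  obtain ⟨b', p', q', hpq', hu, hl⟩ := hadj u l hH.adj_ul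
  have hbb : b' ≠ b := by
    rintro rfl
    obtain ⟨x, hx, rfl⟩ := hπsurj q'
    exact hx (hf ((hπ x hx).trans hl.symm))
  have hup : π u = p' := S.pos _ _ _ _ ((hπ u hH.ne_ul).symm.trans hu)
  have hul : χ ((s(u, l)).map f) = κ (col b' p' q') := by
    rw [Sym2.map_mk, hu, hl, hχ _ _ _ hpq']
  obtain ⟨p₁, q₁, hne₁, hcol⟩ := S.onto b (col b' p' q')
  obtain ⟨x, hx, rfl⟩ := hπsurj p₁
  obtain ⟨y, hy, rfl⟩ := hπsurj q₁
  have hxy : x ≠ y := fun h => hne₁ (by rw [h])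
  -- The repeated colour is either on the unused pair `uv`, against properness at the image of `u`,
  -- or on an edge of the copy.
  by_cases hxyuv : s(x, y) = s(u, v)
  · have : col b p' (π v) = col b' p' q' := by
      rw [← hcol]
      rcases Sym2.eq_iff.1 hxyuv with ⟨rfl, rfl⟩ | ⟨rfl, rfl⟩
      · rw [hup]
      · rw [hup, S.col_symm]
    refine hbb (S.proper b b' p' (π v) q' ?_ hpq' ?_ this).symm
    · rw [← hup]
      exact fun h => hH.ne_uv (hπinj u v hH.ne_ul hH.ne_vl h)
    · rw [← hu, hπ u hH.ne_ul, hup]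
  · have h1 : H.Adj x y := (hH.adj_iff _ _).2 (Or.inl ⟨hxy, hx, hy, hxyuv⟩)
    have h2 : s(x, y) = s(u, l) := by
      refine hinj h1 hH.adj_ul ?_
      simp only
      rw [hul, Sym2.map_mk, hπ x hx, hπ y hy, hχ _ _ _ hne₁, hcol]
    rcases Sym2.eq_iff.1 h2 with ⟨-, h⟩ | ⟨h, -⟩
    · exact hy h
    · exact hx h

theorem exists_position [Fintype V] [Fintype P] (hP : Fintype.card V = Fintype.card P + 1)
    {u v l : V} (huv : u ≠ v) (hul : u ≠ l) (hvl : v ≠ l) {p q : P} (hpq : p ≠ q) :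
    ∃ π : V → P, (∀ x y, x ≠ l → y ≠ l → π x = π y → x = y) ∧ π u = p ∧ π v = q := by
  classical
  have hcard : Fintype.card {x // x ≠ l} = Fintype.card P := by
    rw [Fintype.card_subtype_compl, hP]
    simp
  let e₀ := Fintype.equivOfCardEq hcard
  let e₁ := e₀.trans (Equiv.swap (e₀ ⟨u, hul⟩) p)
  let e₂ := e₁.trans (Equiv.swap (e₁ ⟨v, hvl⟩) q)
  have h1 : e₁ ⟨u, hul⟩ = p := by simp [e₁]
  have h2 : e₁ ⟨v, hvl⟩ ≠ p := by
    rw [← h1]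
    exact e₁.injective.ne fun h => huv (congrArg Subtype.val h).symm
  refine ⟨fun x => if h : x ≠ l then e₂ ⟨x, h⟩ else p, ?_, ?_, ?_⟩
  · intro x y hx hy h
    simp only [dif_pos hx, dif_pos hy] at h
    exact congrArg Subtype.val (e₂.injective h)
  · simp only [dif_pos hul]
    change Equiv.swap _ _ (e₁ ⟨u, hul⟩) = p
    rw [h1, Equiv.swap_apply_of_ne_of_ne h2.symm hpq]
  · simp only [dif_pos hvl]
    change Equiv.swap _ _ (e₁ ⟨v, hvl⟩) = q
    exact Equiv.swap_apply_left _ _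

/-- Some block through `vtx b p` has there an edge of the colour of the new edge. Place `uv` on that
edge and `l` at `y`: `H` omits `uv`, so the colour is free. If the new colour is not in the range of
`κ`, any block through the vertex works. -/
theorem rainbowIn_of_le [Fintype V] [Fintype P] (S : IsRainbowSystem vtx col)
    {H : SimpleGraph V} {u v l : V} (hH : IsRotatedClique H u v l)
    (hP : Fintype.card V = Fintype.card P + 1) {κ : C → K} (hκ : Injective κ) [Nonempty C]
    {χ : Sym2 W → K} (hχ : ∀ b p q, p ≠ q → χ s(vtx b p, vtx b q) = κ (col b p q))
    {b : Bl} {p : P} {y : W} (hxy : vtx b p ≠ y) (hn : ¬ (systemGraph vtx S.pos).Adj (vtx b p) y)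
    {G : SimpleGraph W} (hG : systemGraph vtx S.pos ≤ G) (hadj : G.Adj (vtx b p) y) :
    RainbowIn H G χ := by
  classical
  obtain ⟨b', q, hpq, hb', hj⟩ : ∃ b' q, p ≠ q ∧ vtx b' p = vtx b p ∧
      ∀ i, κ i = χ s(vtx b p, y) → i = col b' p q := by
    by_cases h : ∃ i, κ i = χ s(vtx b p, y)
    · obtain ⟨i, hi⟩ := h
      obtain ⟨b', q, h1, h2, h3⟩ := S.seen b p i
      exact ⟨b', q, h1, h2, fun i' hi' => (hκ (hi'.trans hi.symm)).trans h3.symm⟩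
    · obtain ⟨b', q, h1, h2, -⟩ := S.seen b p (Classical.arbitrary C)
      exact ⟨b', q, h1, h2, fun i hi => absurd ⟨i, hi⟩ h⟩
  rw [← hb'] at hxy hn hadj hj
  obtain ⟨π, hπ, hπu, hπv⟩ := exists_position hP hH.ne_uv hH.ne_ul hH.ne_vl hpq
  have hy : ∀ s, vtx b' s ≠ y := by
    rintro s rfl
    exact hn ⟨b', p, s, fun h => hxy (by rw [h]), rfl, rfl⟩
  let g : V → W := fun x => if x = l then y else vtx b' (π x)
  have gl : g l = y := if_pos rfl
  have gx : ∀ x, x ≠ l → g x = vtx b' (π x) := fun x hx => if_neg hx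
  have gu : g u = vtx b' p := by rw [gx u hH.ne_ul, hπu]
  have hul : χ ((s(u, l)).map g) = χ s(vtx b' p, y) := by rw [Sym2.map_mk, gu, gl]
  have hcol : ∀ x z, x ≠ z → x ≠ l → z ≠ l →
      χ ((s(x, z)).map g) = κ (col b' (π x) (π z)) := by
    intro x z hxz hx hz
    rw [Sym2.map_mk, gx x hx, gx z hz, hχ _ _ _ fun h => hxz (hπ x z hx hz h)]
  have hpull : ∀ x z x' z', x ≠ z → x ≠ l → z ≠ l → x' ≠ z' → x' ≠ l → z' ≠ l →
      col b' (π x) (π z) = col b' (π x') (π z') → s(x, z) = s(x', z') := by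
    intro x z x' z' h1 h2 h3 h4 h5 h6 h
    rcases Sym2.eq_iff.1 (S.rainbow _ _ _ _ _ (fun h => h1 (hπ x z h2 h3 h))
      (fun h => h4 (hπ x' z' h5 h6 h)) h) with ⟨h7, h8⟩ | ⟨h7, h8⟩
    · rw [hπ _ _ h2 h5 h7, hπ _ _ h3 h6 h8]
    · rw [hπ _ _ h2 h6 h7, hπ _ _ h3 h5 h8]
      exact Sym2.eq_swap
  have hnj : ∀ x z, x ≠ z → x ≠ l → z ≠ l → s(x, z) ≠ s(u, v) →
      χ ((s(x, z)).map g) ≠ χ ((s(u, l)).map g) := by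
    intro x z h1 h2 h3 h4 h
    rw [hcol x z h1 h2 h3, hul] at h
    have := hj _ h
    rw [← hπu, ← hπv] at this
    exact h4 (hpull _ _ _ _ h1 h2 h3 hH.ne_uv hH.ne_ul hH.ne_vl this)
  refine ⟨g, ?_, ?_, ?_⟩
  · intro x z h
    by_cases hx : x = l <;> by_cases hz : z = l
    · rw [hx, hz]
    · rw [hx, gl, gx z hz] at h
      exact absurd h.symm (hy _)
    · rw [hz, gl, gx x hx] at h
      exact absurd h (hy _)
    · rw [gx x hx, gx z hz] at h
      exact hπ x z hx hz (S.pos _ _ _ _ h)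
  · intro x z hxz
    rcases (hH.adj_iff _ _).1 hxz with ⟨h1, h2, h3, -⟩ | h
    · rw [gx x h2, gx z h3]
      exact hG ⟨b', _, _, fun h => h1 (hπ x z h2 h3 h), rfl, rfl⟩
    · rcases Sym2.eq_iff.1 h with ⟨rfl, rfl⟩ | ⟨rfl, rfl⟩
      · rw [gu, gl]
        exact hadj
      · rw [gu, gl]
        exact hadj.symm
  · intro e he e' he' h
    simp only at h
    rcases hH.eq_or he with rfl | ⟨x, z, rfl, h1, h2, h3, h4⟩ <;>
      rcases hH.eq_or he' with rfl | ⟨x', z', rfl, h1', h2', h3', h4'⟩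
    · rfl
    · exact absurd h.symm (hnj _ _ h1' h2' h3' h4')
    · exact absurd h (hnj _ _ h1 h2 h3 h4)
    · rw [hcol _ _ h1 h2 h3, hcol _ _ h1' h2' h3'] at h
      exact hpull _ _ _ _ h1 h2 h3 h1' h2' h3' (hκ h)

/-- Each colour occurs on a pair of one block; transport it to `H`, sending the missing pair `uv` to
`ul`. -/
theorem card_colours_le [Fintype V] [Fintype P] [Fintype C] (S : IsRainbowSystem vtx col)
    {H : SimpleGraph V} {u v l : V} (hH : IsRotatedClique H u v l)
    (hP : Fintype.card V = Fintype.card P + 1) (b : Bl) :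
    Fintype.card C ≤ H.edgeSet.ncard := by
  classical
  have hcard : Fintype.card {x // x ≠ l} = Fintype.card P := by
    rw [Fintype.card_subtype_compl, hP]
    simp
  let g : P → V := fun p => ((Fintype.equivOfCardEq hcard).symm p).1
  have hg : Injective g := Subtype.val_injective.comp (Equiv.injective _)
  have hgl : ∀ p, g p ≠ l := fun p => ((Fintype.equivOfCardEq hcard).symm p).2
  choose p q hne hcol using S.onto b
  have hmap : ∀ i j, s(g (p i), g (q i)) = s(g (p j), g (q j)) → i = j := by
    intro i j h
    rw [← Sym2.map_mk, ← Sym2.map_mk] at h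
    rw [← hcol i, ← hcol j]
    rcases Sym2.eq_iff.1 (Sym2.map.injective hg h) with ⟨h1, h2⟩ | ⟨h1, h2⟩
    · rw [h1, h2]
    · rw [h1, h2, S.col_symm]
  have hl : ∀ i, s(g (p i), g (q i)) ≠ s(u, l) := by
    intro i h
    rcases Sym2.eq_iff.1 h with ⟨-, h⟩ | ⟨h, -⟩
    · exact hgl _ h
    · exact hgl _ h
  let F : C → H.edgeSet := fun i =>
    if h : s(g (p i), g (q i)) = s(u, v) then ⟨s(u, l), hH.adj_ul⟩
    else ⟨s(g (p i), g (q i)), (hH.adj_iff _ _).2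
      (Or.inl ⟨hg.ne (hne i), hgl _, hgl _, h⟩)⟩
  have hF : Injective F := by
    intro i j h
    simp only [F] at h
    split_ifs at h with h1 h2 h2
    · exact hmap i j (h1.trans h2.symm)
    · exact absurd (congrArg Subtype.val h).symm (hl j)
    · exact absurd (congrArg Subtype.val h) (hl i)
    · exact hmap i j (congrArg Subtype.val h)
  rw [← Nat.card_eq_fintype_card]
  exact Nat.card_le_card_of_injective F hF

theorem rainbowSat_le_mul [Fintype V] [Fintype P] [Fintype C] [Nonempty C] [Fintype W]
    (S : IsRainbowSystem vtx col) {H : SimpleGraph V} {u v l : V}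
    (hH : IsRotatedClique H u v l) (hP : Fintype.card V = Fintype.card P + 1)
    (hP' : 4 ≤ Fintype.card P) {t : ℕ} (hκ : Fintype.card C ≤ t) (D : ℕ) (F : W → Finset W)
    (hF : ∀ x, (F x).card ≤ D) (hcomp : ∀ b p q, vtx b q ∈ F (vtx b p))
    (hcov : ∀ x y, (∀ b p, x ≠ vtx b p) → x ∈ F y) :
    rainbowSat H t (Fintype.card W) ≤ D * Fintype.card W := by
  obtain ⟨κ⟩ := Function.Embedding.nonempty_of_card_le (α := C) (β := Fin t) (by simpa using hκ)
  have hne : Nonempty (Fin t) := ⟨κ (Classical.arbitrary C)⟩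
  obtain ⟨χ, hχ⟩ := S.exists_colouring (K := Fin t) κ
  refine RainbowSat.rainbowSat_le_mul (S.not_rainbowIn hH hP hP' hχ) D F hF ?_
  intro x y hxy hyx hxy'
  by_cases hx : ∀ b p, x ≠ vtx b p
  · exact absurd (hcov x y hx) hxy'
  push Not at hx
  obtain ⟨b, p, rfl⟩ := hx
  have hn : ¬ (systemGraph vtx S.pos).Adj (vtx b p) y := by
    rintro ⟨b', p', q, hpq, h1, rfl⟩
    rw [h1] at hyx
    exact hyx (hcomp _ _ _)
  refine ⟨hn, fun χ' hχ' => ?_⟩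
  refine S.rainbowIn_of_le hH hP κ.injective (χ := χ') (fun b p q hpq => ?_) hxy hn le_sup_left
    (Or.inr ((SimpleGraph.edge_adj ..).2 ⟨Or.inl ⟨rfl, rfl⟩, hxy⟩))
  have hadj : (systemGraph vtx S.pos).Adj (vtx b p) (vtx b q) := ⟨b, p, q, hpq, rfl, rfl⟩
  rw [hχ' _ hadj, hχ b p q hpq]

end IsRainbowSystem

/-- The classes of a one-factorization of the complete graph on `Option (ZMod (2 * m + 1))`. -/
def factorClass (m : ℕ) : Option (ZMod (2 * m + 1)) → Option (ZMod (2 * m + 1)) →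
    ZMod (2 * m + 1)
  | some a, some b => a + b
  | some a, none => a + a
  | none, some a => a + a
  | none, none => 0

/-- A label distinguishing the edges in each class of the one-factorization `factorClass`. -/
def factorLabel (m : ℕ) : Option (ZMod (2 * m + 1)) → Option (ZMod (2 * m + 1)) → ZMod (m + 1)
  | some a, some b => ((a - b).valMinAbs.natAbs : ZMod (m + 1))
  | _, _ => 0

section Factor

variable {m : ℕ}

theorem factorClass_comm (p q : Option (ZMod (2 * m + 1))) :
    factorClass m p q = factorClass m q p := by
  rcases p with _ | a <;> rcases q with _ | b <;> simp [factorClass, add_comm]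

theorem factorLabel_comm (p q : Option (ZMod (2 * m + 1))) :
    factorLabel m p q = factorLabel m q p := by
  rcases p with _ | a <;> rcases q with _ | b <;> simp only [factorLabel]
  rw [← neg_sub, ZMod.natAbs_valMinAbs_neg]

/-- Exhibits `m + 1` as the inverse of `2`, used to solve for the ends of an edge. -/
theorem two_mul_half (m : ℕ) : (2 : ZMod (2 * m + 1)) * ((m : ZMod (2 * m + 1)) + 1) = 1 := by
  have h : ((2 * m + 1 : ℕ) : ZMod (2 * m + 1)) = 0 := ZMod.natCast_self _
  push_cast at h
  linear_combination h

theorem eq_of_add_self_eq {a b : ZMod (2 * m + 1)} (h : a + a = b + b) : a = b := by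
  have := two_mul_half m
  linear_combination ((m : ZMod (2 * m + 1)) + 1) * h + (b - a) * this

theorem eq_of_factorClass_eq {p q q' : Option (ZMod (2 * m + 1))} (hq : p ≠ q) (hq' : p ≠ q')
    (h : factorClass m p q = factorClass m p q') : q = q' := by
  rcases p with _ | a <;> rcases q with _ | b <;> rcases q' with _ | c <;>
    simp only [factorClass] at h
  · rfl
  · exact absurd rfl hq
  · exact absurd rfl hq'
  · rw [eq_of_add_self_eq h]
  · rfl
  · exact absurd (by rw [add_left_cancel h]) hq'
  · exact absurd (by rw [add_left_cancel h]) hq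
  · rw [add_left_cancel h]

theorem exists_factorClass_eq (p : Option (ZMod (2 * m + 1))) (j : ZMod (2 * m + 1)) :
    ∃ q, p ≠ q ∧ factorClass m p q = j := by
  have h2 := two_mul_half m
  rcases p with _ | a
  · refine ⟨some (j * ((m : ZMod (2 * m + 1)) + 1)), by simp, ?_⟩
    simp only [factorClass]
    linear_combination j * h2
  · by_cases h : a + a = j
    · exact ⟨none, by simp, h⟩
    · refine ⟨some (j - a), fun h' => h ?_, by simp [factorClass]⟩
      have h3 : a = j - a := Option.some_injective _ h'
      linear_combination h3

theorem natAbs_valMinAbs_injective {a b : ZMod (2 * m + 1)}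
    (h : (a.valMinAbs.natAbs : ZMod (m + 1)) = (b.valMinAbs.natAbs : ZMod (m + 1))) :
    a = b ∨ a = -b := by
  have hlt : ∀ c : ZMod (2 * m + 1), c.valMinAbs.natAbs < m + 1 := by
    intro c
    have := ZMod.natAbs_valMinAbs_le c
    omega
  have h1 : a.valMinAbs.natAbs = b.valMinAbs.natAbs := by
    have := congrArg ZMod.val h
    rwa [ZMod.val_natCast_of_lt (hlt a), ZMod.val_natCast_of_lt (hlt b)] at this
  rw [← ZMod.coe_valMinAbs a, ← ZMod.coe_valMinAbs b]
  rcases Int.natAbs_eq_natAbs_iff.1 h1 with h2 | h2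
  · left
    rw [h2]
  · right
    rw [h2]
    push_cast
    rfl

/-- The class gives `a + b` and the label gives `a - b` up to sign, which determines the pair as `2`
is invertible. Label `0` belongs only to the edge at `none`. -/
theorem eq_of_factor_eq {p q p' q' : Option (ZMod (2 * m + 1))} (hpq : p ≠ q) (hpq' : p' ≠ q')
    (hc : factorClass m p q = factorClass m p' q') (hl : factorLabel m p q = factorLabel m p' q') :
    s(p, q) = s(p', q') := by
  have h0 : ∀ a b : ZMod (2 * m + 1), some a ≠ some b →
      ((a - b).valMinAbs.natAbs : ZMod (m + 1)) ≠ 0 := by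
    intro a b hab h
    have h1 : ((a - b).valMinAbs.natAbs : ZMod (m + 1)) =
        (((0 : ZMod (2 * m + 1)).valMinAbs.natAbs : ℕ) : ZMod (m + 1)) := by
      rw [h]
      simp
    rcases natAbs_valMinAbs_injective h1 with h2 | h2
    · exact hab (by rw [sub_eq_zero.1 h2])
    · rw [neg_zero] at h2
      exact hab (by rw [sub_eq_zero.1 h2])
  rcases p with _ | a <;> rcases q with _ | b <;> rcases p' with _ | a' <;>
    rcases q' with _ | b' <;> simp only [factorClass, factorLabel] at hc hl <;>
    first
    | exact absurd rfl hpq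
    | exact absurd rfl hpq'
    | exact absurd hl (h0 _ _ hpq)
    | exact absurd hl.symm (h0 _ _ hpq')
    | (obtain rfl := eq_of_add_self_eq hc; first | rfl | exact Sym2.eq_swap)
    | skip
  rcases natAbs_valMinAbs_injective hl with h | h
  · have h1 : a = a' := eq_of_add_self_eq (by linear_combination hc + h)
    subst h1
    rw [add_left_cancel hc]
  · have h1 : a = b' := eq_of_add_self_eq (by linear_combination hc + h)
    subst h1
    have h2 : b = a' := by linear_combination hc
    rw [h2]
    exact Sym2.eq_swap

theorem exists_factor_eq (j : ZMod (2 * m + 1)) (i : ZMod (m + 1)) :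
    ∃ p q, p ≠ q ∧ factorClass m p q = j ∧ factorLabel m p q = i := by
  have h2 := two_mul_half m
  by_cases hi : i = 0
  · subst hi
    refine ⟨none, some (j * ((m : ZMod (2 * m + 1)) + 1)), by simp, ?_, rfl⟩
    simp only [factorClass]
    linear_combination j * h2
  · have hlt : i.val < m + 1 := ZMod.val_lt i
    have hd : (j + (i.val : ZMod (2 * m + 1))) * ((m : ZMod (2 * m + 1)) + 1) -
        (j - (i.val : ZMod (2 * m + 1))) * ((m : ZMod (2 * m + 1)) + 1) =
        ((i.val : ℕ) : ZMod (2 * m + 1)) := by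
      linear_combination ((i.val : ℕ) : ZMod (2 * m + 1)) * h2
    have hv : ((i.val : ℕ) : ZMod (2 * m + 1)).valMinAbs = (i.val : ℤ) :=
      ZMod.valMinAbs_natCast_of_le_half (by omega)
    have hlab : factorLabel m (some ((j + (i.val : ZMod (2 * m + 1))) *
        ((m : ZMod (2 * m + 1)) + 1))) (some ((j - (i.val : ZMod (2 * m + 1))) *
        ((m : ZMod (2 * m + 1)) + 1))) = i := by
      simp only [factorLabel]
      rw [hd, hv, Int.natAbs_natCast, ZMod.natCast_zmod_val]
    refine ⟨_, _, fun h => hi ?_, ?_, hlab⟩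
    · rw [Option.some_injective _ h] at hd
      rw [sub_self] at hd
      rw [← hd, ZMod.valMinAbs_zero] at hv
      have : i.val = 0 := by exact_mod_cast hv.symm
      exact (ZMod.val_eq_zero i).1 this
    · simp only [factorClass]
      linear_combination j * h2

end Factor

/-- The vertices of a component of the linear hypergraph used for rotated cliques. -/
abbrev SystemVertex (m : ℕ) : Type :=
  {z : Option (ZMod (2 * m + 1)) × (Option (ZMod (2 * m + 1)) → ZMod (m + 1)) // z.2 z.1 = 0}

/-- The vertex in a given position of a given block. -/
def systemVtx (m M R : ℕ) (b : Fin M × (Option (ZMod (2 * m + 1)) → ZMod (m + 1)))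
    (p : Option (ZMod (2 * m + 1))) : (Fin M × SystemVertex m) ⊕ Fin R :=
  .inl (b.1, ⟨(p, update b.2 p 0), by simp⟩)

/-- The colour of a pair of positions in a given block. -/
def systemCol (m M : ℕ) (b : Fin M × (Option (ZMod (2 * m + 1)) → ZMod (m + 1)))
    (p q : Option (ZMod (2 * m + 1))) : ZMod (2 * m + 1) × ZMod (m + 1) :=
  (factorClass m p q, factorLabel m p q + ∑ x, b.2 x)

theorem systemVtx_eq {m M R : ℕ} {b b' : Fin M × (Option (ZMod (2 * m + 1)) → ZMod (m + 1))}
    {p p' : Option (ZMod (2 * m + 1))} :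
    systemVtx m M R b p = systemVtx m M R b' p' ↔
      p = p' ∧ b.1 = b'.1 ∧ ∀ q, q ≠ p → b.2 q = b'.2 q := by
  simp only [systemVtx, Sum.inl.injEq, Prod.mk.injEq, Subtype.mk.injEq]
  constructor
  · rintro ⟨h1, rfl, h2⟩
    refine ⟨rfl, h1, fun q hq => ?_⟩
    have := congrFun h2 q
    rwa [update_of_ne hq, update_of_ne hq] at this
  · rintro ⟨rfl, h1, h2⟩
    refine ⟨h1, rfl, funext fun q => ?_⟩
    by_cases hq : q = p
    · subst hq
      simp
    · rw [update_of_ne hq, update_of_ne hq, h2 q hq]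

/-- Blocks are points of a grid and vertices are axis-parallel lines, the position being the
direction. Points on a common line differ in one coordinate, which excludes triangles in three
directions. Along a line the coordinate sum takes each value once; this shift of the labels makes
the colouring proper and every colour seen. -/
theorem isRainbowSystem_system (m M R : ℕ) :
    IsRainbowSystem (systemVtx m M R) (systemCol m M) where
  pos b p b' p' h := (systemVtx_eq.1 h).1
  linear b b' p q hpq hp hq := by
    obtain ⟨-, h1, h2⟩ := systemVtx_eq.1 hp
    obtain ⟨-, -, h3⟩ := systemVtx_eq.1 hq
    refine Prod.ext h1 (funext fun x => ?_)
    by_cases hx : x = p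
    · exact h3 x (hx ▸ hpq)
    · exact h2 x hx
  triangle b₁ b₂ b₃ p q s hpq hqs hps h12 h23 h31 := by
    obtain ⟨-, h1, h2⟩ := systemVtx_eq.1 h12
    obtain ⟨-, -, h3⟩ := systemVtx_eq.1 h23
    obtain ⟨-, -, h4⟩ := systemVtx_eq.1 h31
    refine Prod.ext h1 (funext fun x => ?_)
    by_cases hx : x = p
    · subst hx
      rw [h3 x hpq, h4 x hps]
    · exact h2 x hx
  col_symm b p q := by simp only [systemCol, factorClass_comm p q, factorLabel_comm p q]
  rainbow b p q p' q' hpq hpq' h := by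
    simp only [systemCol, Prod.mk.injEq, add_left_inj] at h
    exact eq_of_factor_eq hpq hpq' h.1 h.2
  proper b b' p q q' hpq hpq' hp h := by
    obtain ⟨-, h1, h2⟩ := systemVtx_eq.1 hp
    simp only [systemCol, Prod.mk.injEq] at h
    obtain rfl := eq_of_factorClass_eq hpq hpq' h.1
    have h3 := add_left_cancel h.2
    rw [← Finset.add_sum_erase _ _ (Finset.mem_univ p),
      ← Finset.add_sum_erase _ b'.2 (Finset.mem_univ p),
      Finset.sum_congr rfl fun x hx => h2 x (Finset.ne_of_mem_erase hx)] at h3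
    have h4 := add_right_cancel h3
    refine Prod.ext h1 (funext fun x => ?_)
    by_cases hx : x = p
    · rw [hx, h4]
    · exact h2 x hx
  seen b p i := by
    obtain ⟨q, hpq, hq⟩ := exists_factorClass_eq p i.1
    -- The coordinate `p` is chosen so that the coordinate sum shifts the label to `i.2`.
    refine ⟨(b.1, update b.2 p (i.2 - factorLabel m p q - ∑ x ∈ Finset.univ.erase p, b.2 x)), q,
      hpq, ?_, ?_⟩
    · exact systemVtx_eq.2 ⟨rfl, rfl, fun x hx => update_of_ne hx _ _⟩
    · refine Prod.ext hq ?_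
      simp only [systemCol]
      rw [← Finset.add_sum_erase _ _ (Finset.mem_univ p), update_self,
        Finset.sum_congr rfl fun x hx => update_of_ne (Finset.ne_of_mem_erase hx) _ _]
      ring
  onto b i := by
    obtain ⟨p, q, hpq, h1, h2⟩ := exists_factor_eq i.1 (i.2 - ∑ x, b.2 x)
    refine ⟨p, q, hpq, Prod.ext h1 ?_⟩
    simp only [systemCol, h2]
    ring

/-- Take `n / D` disjoint pieces of `D` vertices and `n % D` isolated vertices. Edges of a saturated
extension stay in a piece or meet the remainder, so `F x` has at most `2 * D` elements. -/
theorem rainbowSat_le_of_isRotatedClique [Fintype V] {H : SimpleGraph V} {u v l : V}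
    (hH : IsRotatedClique H u v l) {m : ℕ} (hm : 1 ≤ m) (hV : Fintype.card V = 2 * m + 3) {t : ℕ}
    (ht : H.edgeSet.ncard ≤ t) (n : ℕ) :
    rainbowSat H t n ≤ 2 * Fintype.card (SystemVertex m) * n := by
  classical
  set D := Fintype.card (SystemVertex m) with hD
  have hDpos : 0 < D := Fintype.card_pos_iff.2 ⟨⟨(none, 0), rfl⟩⟩
  have hcardP : Fintype.card (Option (ZMod (2 * m + 1))) = 2 * m + 2 := by
    rw [Fintype.card_option, ZMod.card]
  have hP : Fintype.card V = Fintype.card (Option (ZMod (2 * m + 1))) + 1 := by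
    rw [hV, hcardP]
  have hn : Fintype.card ((Fin (n / D) × SystemVertex m) ⊕ Fin (n % D)) = n := by
    rw [Fintype.card_sum, Fintype.card_prod, Fintype.card_fin, Fintype.card_fin]
    exact Nat.div_add_mod' n D
  -- The count needs a block, and `n / D` may be `0`; hence a separate system with one piece.
  have hC := (isRainbowSystem_system m 1 0).card_colours_le hH hP (0, 0)
  have := (isRainbowSystem_system m (n / D) (n % D)).rainbowSat_le_mul hH hP (by omega)
    (hC.trans ht) (2 * D)
    (fun x => (Finset.univ.image Sum.inr) ∪
      Sum.elim (fun z => Finset.univ.image fun w => Sum.inl (z.1, w)) (fun _ => ∅) x) ?_ ?_ ?_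
  · rwa [hn] at this
  · intro x
    refine (Finset.card_union_le _ _).trans ?_
    have h1 : ((Finset.univ : Finset (Fin (n % D))).image
        (Sum.inr : _ → (Fin (n / D) × SystemVertex m) ⊕ Fin (n % D))).card ≤ D := by
      refine Finset.card_image_le.trans ?_
      rw [Finset.card_univ, Fintype.card_fin]
      exact (Nat.mod_lt n hDpos).le
    have h2 : (Sum.elim (fun z => Finset.univ.image fun w => Sum.inl (z.1, w)) (fun _ => ∅) x :
        Finset ((Fin (n / D) × SystemVertex m) ⊕ Fin (n % D))).card ≤ D := by
      rcases x with z | z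
      · exact Finset.card_image_le.trans_eq Finset.card_univ
      · simp
    omega
  · intro b p q
    refine Finset.mem_union_right _ ?_
    simp only [systemVtx, Sum.elim_inl]
    exact Finset.mem_image_of_mem _ (Finset.mem_univ _)
  · intro x y hx
    refine Finset.mem_union_left _ ?_
    rcases x with ⟨μ, ⟨⟨p, a⟩, hpa⟩⟩ | z
    · refine absurd ?_ (hx (μ, a) p)
      simp only [systemVtx, Sum.inl.injEq, Prod.mk.injEq, Subtype.mk.injEq, true_and]
      exact (update_eq_self_iff.2 hpa.symm).symm
    · exact Finset.mem_image_of_mem _ (Finset.mem_univ _)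

end RotatedClique

open Filter

/-! ### From finite estimates to asymptotics -/

section Asymptotic

variable {V : Type*} {H : SimpleGraph V} {t : ℕ}

theorem rainbowSat_isBigO_sq {a b : V} (hab : H.Adj a b) (ht : 0 < t) :
    (fun n : ℕ => (rainbowSat H t n : ℝ)) =O[atTop] fun n : ℕ => (n : ℝ) ^ 2 := by
  refine Asymptotics.IsBigO.of_bound 1 (Eventually.of_forall fun n => ?_)
  obtain ⟨G, χ, -, hm⟩ := exists_saturated_ncard_eq H hab ht n
  have h := ncard_edgeSet_le_mul G n (fun _ => Finset.univ) (by simp) (by simp)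
  rw [hm, Fintype.card_fin] at h
  rw [Real.norm_of_nonneg (by positivity), Real.norm_of_nonneg (by positivity), one_mul, sq]
  exact_mod_cast h

theorem rainbowSat_isBigO_id {C N : ℕ} (h : ∀ n, N ≤ n → rainbowSat H t n ≤ C * n) :
    (fun n : ℕ => (rainbowSat H t n : ℝ)) =O[atTop] fun n : ℕ => (n : ℝ) := by
  refine Asymptotics.IsBigO.of_bound C ((eventually_ge_atTop N).mono fun n hn => ?_)
  rw [Real.norm_of_nonneg (by positivity), Real.norm_of_nonneg (by positivity)]
  exact_mod_cast h n hn

theorem isBigO_id_rainbowSat [Finite V] (hconn : H.Connected) (hcard : 3 ≤ Nat.card V) {a b : V}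
    (hab : H.Adj a b) (ht : 0 < t) :
    (fun n : ℕ => (n : ℝ)) =O[atTop] fun n : ℕ => (rainbowSat H t n : ℝ) := by
  refine Asymptotics.IsBigO.of_bound 3 ((eventually_ge_atTop 2).mono fun n hn => ?_)
  obtain ⟨G, χ, hsat, hm⟩ := exists_saturated_ncard_eq H hab ht n
  have : Nonempty (Fin t) := ⟨⟨0, ht⟩⟩
  have h := hsat.card_le_two_mul_add_one hconn hcard
  rw [hm, Fintype.card_fin] at h
  rw [Real.norm_of_nonneg (by positivity), Real.norm_of_nonneg (by positivity)]
  have h2 : n ≤ 3 * rainbowSat H t n := by omega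
  exact_mod_cast h2

theorem isBigO_sq_rainbowSat {T : Type*} [Fintype T] {a b : V} (hab : H.Adj a b) (ht : 0 < t)
    (hT : ∀ (n : ℕ) (G : SimpleGraph (Fin n)) (χ : Sym2 (Fin n) → Fin t), Saturated H G χ →
      ∃ A : Fin n → T, ∀ x y, x ≠ y → A x = A y → G.Adj x y) :
    (fun n : ℕ => (n : ℝ) ^ 2) =O[atTop] fun n : ℕ => (rainbowSat H t n : ℝ) := by
  set q := Fintype.card T with hq
  refine Asymptotics.IsBigO.of_bound (4 * q)
    -- For `n ≥ 2q` the term `q n` is at most half of `n ^ 2` and can be absorbed.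
    ((eventually_ge_atTop (2 * q)).mono fun n hn => ?_)
  obtain ⟨G, χ, hsat, hm⟩ := exists_saturated_ncard_eq H hab ht n
  obtain ⟨A, hA⟩ := hT n G χ hsat
  have h := sq_card_le_of_label G A hA
  rw [hm, Fintype.card_fin, ← hq] at h
  rw [Real.norm_of_nonneg (by positivity), Real.norm_of_nonneg (by positivity)]
  have h2 : n ^ 2 ≤ 4 * q * rainbowSat H t n := by nlinarith
  exact_mod_cast h2

theorem isBigO_mul_log_rainbowSat {T : Type*} [Fintype T] {a b : V} (hab : H.Adj a b)
    (ht : 0 < t)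
    (hT : ∀ (n : ℕ) (G : SimpleGraph (Fin n)) (χ : Sym2 (Fin n) → Fin t), Saturated H G χ →
      ∃ A : Fin n → T, ∀ x y, x ≠ y → ¬ G.Adj x y → A x = A y →
        ∃ z, G.Adj x z ∧ G.Adj y z ∧ χ s(x, z) ≠ χ s(y, z)) :
    (fun n : ℕ => (n : ℝ) * Real.log n) =O[atTop] fun n : ℕ => (rainbowSat H t n : ℝ) := by
  classical
  set q := Fintype.card T with hq
  have hlog : 0 ≤ Real.log ((2 * t : ℝ) ^ 2) := by
    refine Real.log_nonneg (one_le_pow₀ ?_)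
    have : (1 : ℝ) ≤ t := by exact_mod_cast ht
    linarith
  refine Asymptotics.IsBigO.of_bound (4 * Real.log ((2 * t : ℝ) ^ 2))
    ((eventually_ge_atTop (4 * q ^ 2 + 1)).mono fun n hn => ?_)
  obtain ⟨G, χ, hsat, hm⟩ := exists_saturated_ncard_eq H hab ht n
  obtain ⟨A, hA⟩ := hT n G χ hsat
  -- This base gives `(D + 1) * t ^ D ≤ (2 * t) ^ D ≤ √n`, so at most half of the vertices have
  -- degree at most `D` once `n > 4 * q ^ 2`.
  set D := Nat.log ((2 * t) ^ 2) n with hD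
  have h1 := card_filter_degree_le G χ A hA (by simpa using ht) D
    (by simpa using Nat.log_le_self _ n)
  have h2 := sub_card_filter_degree_mul_le G D
  rw [hm] at h2
  set l := (Finset.univ.filter fun x => G.degree x ≤ D).card
  rw [Fintype.card_fin, ← hq] at h1
  rw [Fintype.card_fin] at h2
  have hpow : ((2 * t) ^ 2) ^ D ≤ n := Nat.pow_log_le_self _ (by omega)
  have h3 : l ≤ q * (2 * t) ^ D := by
    rw [mul_pow]
    refine h1.trans ?_
    rw [mul_assoc]
    exact Nat.mul_le_mul_left _ (Nat.mul_le_mul_right _ (Nat.lt_two_pow_self))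
  have h4 : 2 * l ≤ n := by
    have h5 : l ^ 2 ≤ q ^ 2 * n := by
      calc l ^ 2 ≤ (q * (2 * t) ^ D) ^ 2 := Nat.pow_le_pow_left h3 2
        _ = q ^ 2 * ((2 * t) ^ 2) ^ D := by rw [mul_pow, ← pow_mul, ← pow_mul, mul_comm D]
        _ ≤ _ := Nat.mul_le_mul_left _ hpow
    by_contra! hcon
    nlinarith
  have h6 : n * (D + 1) ≤ 4 * rainbowSat H t n := by
    have h7 : n ≤ 2 * (n - l) := by omega
    calc n * (D + 1) ≤ 2 * (n - l) * (D + 1) := Nat.mul_le_mul_right _ h7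
      _ = 2 * ((n - l) * (D + 1)) := by ring
      _ ≤ 2 * (2 * rainbowSat H t n) := Nat.mul_le_mul_left _ h2
      _ = _ := by ring
  have hn1 : (1 : ℝ) ≤ n := by exact_mod_cast (show 1 ≤ n by omega)
  have h8 : Real.log n ≤ (D + 1) * Real.log ((2 * t : ℝ) ^ 2) := by
    have h9 : n < ((2 * t) ^ 2) ^ (D + 1) := by
      refine Nat.lt_pow_succ_log_self ?_ n
      nlinarith
    have h10 : (n : ℝ) ≤ ((2 * t : ℝ) ^ 2) ^ (D + 1) := by exact_mod_cast h9.le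
    have := Real.log_le_log (by linarith) h10
    rw [Real.log_pow] at this
    exact_mod_cast this
  have h6' : (n : ℝ) * (D + 1) ≤ 4 * rainbowSat H t n := by exact_mod_cast h6
  rw [Real.norm_of_nonneg (mul_nonneg (by positivity) (Real.log_nonneg hn1)),
    Real.norm_of_nonneg (by positivity)]
  calc (n : ℝ) * Real.log n ≤ n * ((D + 1) * Real.log ((2 * t : ℝ) ^ 2)) :=
        mul_le_mul_of_nonneg_left h8 (by positivity)
    _ = (n * (D + 1)) * Real.log ((2 * t : ℝ) ^ 2) := by ring
    _ ≤ (4 * rainbowSat H t n) * Real.log ((2 * t : ℝ) ^ 2) :=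
        mul_le_mul_of_nonneg_right h6' hlog
    _ = _ := by ring

/-- Apply the bound with `L = Nat.log 2 n + 1`; the condition `L * c ≤ n` holds eventually because
`log n = o(n)`. -/
theorem rainbowSat_isBigO_mul_log {c : ℕ}
    (h : ∀ n L, n ≤ 2 ^ L → L * c ≤ n → rainbowSat H t n ≤ L * c * n) :
    (fun n : ℕ => (rainbowSat H t n : ℝ)) =O[atTop] fun n : ℕ => (n : ℝ) * Real.log n := by
  have hlog2 : 0 < Real.log 2 := Real.log_pos (by norm_num)
  have hL : ∀ n : ℕ, 2 ≤ n → ((Nat.log 2 n + 1 : ℕ) : ℝ) ≤ 2 / Real.log 2 * Real.log n := by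
    intro n hn
    have h1 : 2 ^ Nat.log 2 n ≤ n := Nat.pow_log_le_self 2 (by omega)
    have h2 : ((2 : ℝ) ^ Nat.log 2 n) ≤ n := by exact_mod_cast h1
    have h3 := Real.log_le_log (by positivity) h2
    rw [Real.log_pow] at h3
    have h4 : Real.log 2 ≤ Real.log n :=
      Real.log_le_log (by norm_num) (by exact_mod_cast hn)
    rw [div_mul_eq_mul_div, le_div_iff₀ hlog2]
    push_cast
    linarith
  have hsmall : ∀ᶠ n : ℕ in atTop, 2 / Real.log 2 * Real.log n * c ≤ n := by
    have h1 := (Real.isLittleO_log_id_atTop.comp_tendsto tendsto_natCast_atTop_atTop).bound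
      (show 0 < 1 / (2 / Real.log 2 * (c + 1)) by positivity)
    filter_upwards [h1, eventually_ge_atTop 1] with n hn hn1
    have hn1' : (1 : ℝ) ≤ n := by exact_mod_cast hn1
    simp only [comp_apply, id] at hn
    rw [Real.norm_of_nonneg (Real.log_nonneg hn1'), Real.norm_of_nonneg (by positivity),
      div_mul_eq_mul_div, one_mul, le_div_iff₀ (by positivity)] at hn
    have h2 : 0 ≤ 2 / Real.log 2 * Real.log n := by
      have := Real.log_nonneg hn1'
      positivity
    nlinarith
  refine Asymptotics.IsBigO.of_bound (2 / Real.log 2 * c) ?_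
  filter_upwards [hsmall, eventually_ge_atTop 2] with n hn hn2
  have hn1 : (1 : ℝ) ≤ n := by exact_mod_cast (show 1 ≤ n by omega)
  have hLn := hL n hn2
  have h1 : (Nat.log 2 n + 1) * c ≤ n := by
    have : ((Nat.log 2 n + 1 : ℕ) : ℝ) * c ≤ n :=
      (mul_le_mul_of_nonneg_right hLn (by positivity)).trans hn
    exact_mod_cast this
  have h2 := h n (Nat.log 2 n + 1) (Nat.lt_pow_succ_log_self (by norm_num) n).le h1
  have h3 : (rainbowSat H t n : ℝ) ≤ ((Nat.log 2 n + 1 : ℕ) : ℝ) * c * n := by exact_mod_cast h2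
  rw [Real.norm_of_nonneg (by positivity),
    Real.norm_of_nonneg (mul_nonneg (by positivity) (Real.log_nonneg hn1))]
  calc (rainbowSat H t n : ℝ) ≤ ((Nat.log 2 n + 1 : ℕ) : ℝ) * c * n := h3
    _ ≤ 2 / Real.log 2 * Real.log n * c * n := by gcongr
    _ = _ := by ring

end Asymptotic

/-! ### Stars, conical vertices and rotated cliques -/

section Shapes

variable {V : Type*} {H : SimpleGraph V}

theorem IsConical.adj [Finite V] {v : V} (h : IsConical H v) (w : V) (hw : w ≠ v) :
    H.Adj v w := by
  have hsub : H.neighborSet v ⊆ {v}ᶜ := by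
    intro x hx hxv
    rw [hxv] at hx
    exact (H.loopless.irrefl v) hx
  have heq := Set.eq_of_subset_of_ncard_le hsub (by
    rw [h, Set.ncard_compl, Set.ncard_singleton]) (Set.toFinite _)
  change w ∈ H.neighborSet v
  rw [heq]
  exact hw

theorem IsStar.exists_centre (h : IsStar H) :
    ∃ v, (∀ w, w ≠ v → H.Adj v w) ∧ ∀ a b, H.Adj a b → a = v ∨ b = v := by
  obtain ⟨k, ⟨e⟩⟩ := h
  have hinl : ∀ i : Fin 1, e.symm (Sum.inl i) = e.symm (Sum.inl 0) := fun i => by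
    rw [Subsingleton.elim i 0]
  refine ⟨e.symm (Sum.inl 0), fun w hw => ?_, fun a b hab => ?_⟩
  · rw [← e.map_adj_iff, RelIso.apply_symm_apply]
    rcases hew : e w with i | i
    · refine absurd ?_ hw
      rw [← hinl i, ← hew, RelIso.symm_apply_apply]
    · simp
  · rw [← e.map_adj_iff] at hab
    rcases hea : e a with i | i
    · left
      rw [← hinl i, ← hea, RelIso.symm_apply_apply]
    · rcases heb : e b with j | j
      · right
        rw [← hinl j, ← heb, RelIso.symm_apply_apply]
      · rw [hea, heb] at hab
        simp at hab

theorem isStar_of_conical [Finite V] {v : V} (h1 : ∀ w, w ≠ v → H.Adj v w)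
    (h2 : ∀ a b, a ≠ v → b ≠ v → ¬ H.Adj a b) : IsStar H := by
  classical
  have := Fintype.ofFinite V
  refine ⟨Fintype.card {w // ¬ w = v}, ⟨?_⟩⟩
  let e : V ≃ Fin 1 ⊕ Fin (Fintype.card {w // ¬ w = v}) :=
    (Equiv.sumCompl (· = v)).symm.trans
      (Equiv.sumCongr (Equiv.ofUnique _ _) (Fintype.equivFin _))
  have hv : ∃ i, e v = Sum.inl i := by
    refine ⟨default, ?_⟩
    simp only [e, Equiv.trans_apply]
    rw [Equiv.sumCompl_symm_apply_of_pos (p := (· = v)) rfl]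
    rfl
  have hw : ∀ w, w ≠ v → ∃ i, e w = Sum.inr i := by
    intro w hw
    refine ⟨Fintype.equivFin _ ⟨w, hw⟩, ?_⟩
    simp only [e, Equiv.trans_apply]
    rw [Equiv.sumCompl_symm_apply_of_neg (p := (· = v)) hw]
    rfl
  refine ⟨e, ?_⟩
  intro a b
  obtain ⟨i, hi⟩ := hv
  by_cases ha : a = v <;> by_cases hb : b = v
  · subst ha
    subst hb
    simp [hi]
  · obtain ⟨j, hj⟩ := hw b hb
    subst ha
    simp [hi, hj, h1 b hb]
  · obtain ⟨j, hj⟩ := hw a ha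
    subst hb
    simp [hi, hj, (h1 a ha).symm]
  · obtain ⟨j, hj⟩ := hw a ha
    obtain ⟨j', hj'⟩ := hw b hb
    simp [hj, hj', h2 a b ha hb]

theorem isRotatedClique_rotatedClique {r : ℕ} (hr : 2 ≤ r) :
    IsRotatedClique (rotatedClique r) ⟨0, by omega⟩ ⟨1, by omega⟩ ⟨r, by omega⟩ where
  ne_uv := by simp
  ne_ul := by
    simp only [ne_eq, Fin.mk.injEq]
    omega
  ne_vl := by
    simp only [ne_eq, Fin.mk.injEq]
    omega
  adj_iff x y := by
    obtain ⟨x, hx⟩ := x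
    obtain ⟨y, hy⟩ := y
    simp only [rotatedClique, SimpleGraph.fromRel_adj, ne_eq, Fin.mk.injEq, Sym2.eq_iff]
    omega

theorem IsRotatedClique.of_iso {V' : Type*} {H' : SimpleGraph V'} (e : H ≃g H') {u v l : V'}
    (h : IsRotatedClique H' u v l) : IsRotatedClique H (e.symm u) (e.symm v) (e.symm l) where
  ne_uv := e.symm.injective.ne h.ne_uv
  ne_ul := e.symm.injective.ne h.ne_ul
  ne_vl := e.symm.injective.ne h.ne_vl
  adj_iff x y := by
    have heq : ∀ z w, z = e.symm w ↔ e z = w := fun z w => by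
      constructor
      · rintro rfl
        exact e.apply_symm_apply w
      · rintro rfl
        exact (e.symm_apply_apply z).symm
    rw [← e.map_adj_iff, h.adj_iff]
    simp only [Sym2.eq_iff, heq, ne_eq, EmbeddingLike.apply_eq_iff_eq]

end Shapes

end RainbowSat

/-! ### The main theorem -/

theorem mainTheorem1 {V : Type*} [Finite V] (H : SimpleGraph V)
    (hconn : H.Connected) (hcard : 3 ≤ Nat.card V)
    (t : ℕ) (ht : H.edgeSet.ncard ≤ t) :
    (RainbowSat.IsStar H →
      (fun n : ℕ => (RainbowSat.rainbowSat H t n : ℝ)) =Θ[Filter.atTop]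
        fun n : ℕ => (n : ℝ) ^ 2) ∧
    ((∃ v, RainbowSat.IsConical H v) → ¬ RainbowSat.IsStar H →
      (fun n : ℕ => (RainbowSat.rainbowSat H t n : ℝ)) =Θ[Filter.atTop]
        fun n : ℕ => (n : ℝ) * Real.log n) ∧
    ((∀ x y, H.Adj x y → RainbowSat.IsTriangleEdge H x y) →
      (fun n : ℕ => (RainbowSat.rainbowSat H t n : ℝ)) =Θ[Filter.atTop]
        fun n : ℕ => (n : ℝ) * Real.log n) ∧
    ((∃ x y, H.Adj x y ∧ ¬ RainbowSat.IsPendantEdge H x y ∧ ¬ RainbowSat.IsTriangleEdge H x y) →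
      (fun n : ℕ => (RainbowSat.rainbowSat H t n : ℝ)) =Θ[Filter.atTop]
        fun n : ℕ => (n : ℝ)) ∧
    ((∃ r : ℕ, 4 ≤ r ∧ Even r ∧ Nonempty (H ≃g RainbowSat.rotatedClique r)) →
      (fun n : ℕ => (RainbowSat.rainbowSat H t n : ℝ)) =Θ[Filter.atTop]
        fun n : ℕ => (n : ℝ)) := by
  classical
  have := Fintype.ofFinite V
  obtain ⟨a₀⟩ := hconn.nonempty
  obtain ⟨b₀, -, -, hab₀⟩ := RainbowSat.exists_adj_of_connected hconn hcard a₀ a₀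
  rw [or_self_iff] at hab₀
  have htpos : 0 < t := by
    refine lt_of_lt_of_le ?_ ht
    rw [Set.ncard_pos (Set.toFinite _)]
    exact ⟨s(a₀, b₀), hab₀⟩
  have hK : Nonempty (Fin t) := ⟨⟨0, htpos⟩⟩
  have hlin := RainbowSat.isBigO_id_rainbowSat hconn hcard hab₀ htpos
  refine ⟨fun hstar => ?_, fun ⟨v, hv⟩ hstar => ?_, fun htri => ?_, ?_, ?_⟩
  · refine ⟨RainbowSat.rainbowSat_isBigO_sq hab₀ htpos, ?_⟩
    obtain ⟨v, hv, hv'⟩ := hstar.exists_centre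
    -- Labels are sets of colours: `2 ^ t` of them, independently of `n`.
    refine RainbowSat.isBigO_sq_rainbowSat (T := Set (Fin t)) hab₀ htpos fun n G χ hsat =>
      ⟨fun x => {i | RainbowSat.AvoidsAt H v G χ x i}, fun x y hxy hA => ?_⟩
    by_contra hn
    obtain ⟨-, a, b, c, hab, hac, hbc⟩ :=
      hsat.exists_common_neighbour_of_conical hcard hv hxy hn hA
    rcases hv' a b hab with rfl | rfl
    · rcases hv' b c hbc with rfl | rfl
      · exact hab.ne rfl
      · exact hac.ne rfl
    · rcases hv' a c hac with rfl | rfl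
      · exact hab.ne rfl
      · exact hbc.ne rfl
  · have hv' := hv.adj
    -- An edge missing the conical vertex forms a triangle with it, so the triangle construction
    -- applies.
    obtain ⟨a, b, ha, hb, hab⟩ : ∃ a b, a ≠ v ∧ b ≠ v ∧ H.Adj a b := by
      by_contra! h
      exact hstar (RainbowSat.isStar_of_conical hv' h)
    refine ⟨RainbowSat.rainbowSat_isBigO_mul_log (RainbowSat.rainbowSat_le_of_triangle ht hconn
      hcard hab (hv' a ha).symm (hv' b hb).symm), ?_⟩
    exact RainbowSat.isBigO_mul_log_rainbowSat (T := Set (Fin t)) hab₀ htpos fun n G χ hsat =>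
      ⟨fun x => {i | RainbowSat.AvoidsAt H v G χ x i}, fun x y hxy hn hA =>
        (hsat.exists_common_neighbour_of_conical hcard hv' hxy hn hA).1⟩
  · obtain ⟨-, w, haw, hbw⟩ := htri a₀ b₀ hab₀
    refine ⟨RainbowSat.rainbowSat_isBigO_mul_log (RainbowSat.rainbowSat_le_of_triangle ht hconn
      hcard hab₀ haw hbw), ?_⟩
    refine RainbowSat.isBigO_mul_log_rainbowSat (T := Unit) hab₀ htpos fun n G χ hsat =>
      ⟨fun _ => (), fun x y hxy hn _ => ?_⟩
    obtain ⟨f, a, b, -, hab, rfl, rfl, hadj, hinj, -⟩ :=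
      hsat.exists_copy_through hxy hn (Classical.arbitrary _)
    obtain ⟨-, c, hac, hbc⟩ := htri a b hab
    exact RainbowSat.Saturated.exists_common_neighbour_of_triangle hadj hinj hab hac hbc
  · rintro ⟨x, y, hxy, hp, htri⟩
    refine ⟨RainbowSat.rainbowSat_isBigO_id (RainbowSat.rainbowSat_le_of_not_triangle ht hconn
      hcard ⟨x, y, hxy, ?_, ?_, fun z hz => htri ⟨hxy, z, hz⟩⟩), hlin⟩
    · have h1 : H.degree x ≠ 1 := fun h => hp ⟨hxy, Or.inl (by
        rw [Set.ncard_eq_toFinset_card']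
        exact h)⟩
      have h2 : 0 < H.degree x := (SimpleGraph.degree_pos_iff_exists_adj _ _).2 ⟨y, hxy⟩
      omega
    · have h1 : H.degree y ≠ 1 := fun h => hp ⟨hxy, Or.inr (by
        rw [Set.ncard_eq_toFinset_card']
        exact h)⟩
      have h2 : 0 < H.degree y := (SimpleGraph.degree_pos_iff_exists_adj _ _).2 ⟨x, hxy.symm⟩
      omega
  · rintro ⟨r, hr, hev, ⟨e⟩⟩
    obtain ⟨k, hk⟩ := hev
    -- With `r = 2k` the one-factorization is on `2m + 2 = r` points, so `m = k - 1`.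
    have hV : Fintype.card V = 2 * (k - 1) + 3 := by
      rw [Fintype.card_congr e.toEquiv, Fintype.card_fin]
      omega
    exact ⟨RainbowSat.rainbowSat_isBigO_id (N := 0) fun n _ =>
      RainbowSat.rainbowSat_le_of_isRotatedClique
        ((RainbowSat.isRotatedClique_rotatedClique (by omega)).of_iso e)
        (show 1 ≤ k - 1 by omega) hV ht n, hlin⟩
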